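/- Let $p>0$, let $f:\mathbf R\to\mathbf R$ be a nonconstant $C^\infty$ function, periodic with (not necessarily least) period $p$, let $n\ge4$ be an integer, $V$ a real vector space of dimension $n-2$, $\langle\,,\rangle$ a pseudo-Euclidean inner product on $V$ (a nondegenerate symmetric bilinear form of any signature), and $A:V\to V$ a nonzero, traceless, $\langle\,,\rangle$-self-adjoint linear operator. Let $\mathcal E$ be the space of all $C^\infty$ solutions $u:\mathbf R\to V$ of $\ddot u(t)=f(t)u(t)+Au(t)$. For $u,w\in\mathcal E$ the function $\Omega(u,w)=\langle\dot u,w\rangle-\langle u,\dot w\rangle$ is constant, and is treated as a real number; let $(Tu)(t)=u(t-p)$. Let $G=\mathbf Z\times\mathbf R\times\mathcal E$ be the group with the operation $$(k,q,u)\cdot(l,r,w)=(k+l,\;q+r-\Omega(u,T^lw),\;T^{-l}u+w),$$ acting on the manifold $\widehat M=\mathbf R^2\times V$ by $$(k,q,u)\cdot(t,s,v)=(t+kp,\;s+q-\langle\dot u(t),2v+u(t)\rangle,\;v+u(t)),$$ and let $\Pi:G\to\mathbf Z$, $\Pi(k,q,u)=k$. A free action of a group $\Gamma$ on $\widehat M$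 by diffeomorphisms is called properly discontinuous if there is a surjective local diffeomorphism $\pi:\widehat M\to M$ onto some smooth manifold $M$ whose fibres are precisely the $\Gamma$-orbits; then $M=\widehat M/\Gamma$ is called the quotient. A lattice in a finite-dimensional real vector space is an additive subgroup generated by some basis. Then the following two conditions are equivalent. (i) Some subgroup $\Gamma\subset G$ acts on $\widehat M$ freely and properly discontinuously with a compact quotient manifold $M=\widehat M/\Gamma$, and satisfies $\Pi(\Gamma)=\mathbf Z$. (ii) There exist a $C^\infty$ function $B:\mathbf R\to\mathrm{End}(V)$, periodic of period $p$, with $\dot B+B^2=f\,\mathrm{Id}+A$, a lattice $\Sigma$ in $\mathcal W=\mathbf R\times\mathcal L$, a linear functional $\varphi\in\mathcal L^*$, and $\theta\in[0,\infty)$, where $\mathcal L$ is the vector space of all solutions $w:\mathbf R\to V$ of $\dot w(t)=B(t)w(t)$, such that a) $\Sigma\cap(\mathbf R\times\{0\})=\mathbf Z\theta\times\{0\}$, b) $\Psi(\Sigma)=\Sigma$ for $\Psi:\mathcal W\to\mathcal W$ given by $\Psi(r,w)=(r+\varphi(w),Tw)$, where $(Tw)(t)=w(t-p)$, c) for all $u,w$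 in the image $\Lambda$ of $\Sigma$ under the projection $\mathcal W\to\mathcal L$, the function $\langle\dot u,w\rangle-\langle u,\dot w\rangle$ is constant and its value $\Omega(u,w)$ lies in $\mathbf Z\theta$. -/

import Mathlib

open scoped ContDiff Manifold

universe u

/-- The data `(f, p, n, V, ⟨ , ⟩, A)`.  The norm on the finite-dimensional space `V` is auxiliary: all
norms on `V` are equivalent, and it only serves to speak of smooth `V`-valued functions and of the
manifold structure of `ℝ² × V`.  The geometric structure is the pseudo-Euclidean form `ip`. -/
structure ECSData (V : Type u) [NormedAddCommGroup V] [NormedSpace ℝ V] where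
  /-- the nonconstant smooth periodic function -/
  f : ℝ → ℝ
  /-- a (not necessarily minimal) period of `f` -/
  p : ℝ
  /-- the dimension of `ℝ² × V` -/
  n : ℕ
  /-- the pseudo-Euclidean inner product, of any signature -/
  ip : LinearMap.BilinForm ℝ V
  /-- the nonzero traceless self-adjoint operator -/
  A : V →L[ℝ] V
  f_smooth : ContDiff ℝ ∞ f
  f_nonconstant : ¬ ∃ c : ℝ, ∀ t, f t = c
  p_pos : 0 < p
  f_periodic : Function.Periodic f p
  four_le_n : 4 ≤ n
  finrank_add_two : Module.finrank ℝ V + 2 = n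
  ip_symm : ip.IsSymm
  ip_nondegenerate : ip.Nondegenerate
  A_ne_zero : A ≠ 0
  A_traceless : LinearMap.trace ℝ V (A : V →ₗ[ℝ] V) = 0
  A_selfAdjoint : ∀ v w : V, ip (A v) w = ip v (A w)

/-- `S` is a lattice in the real vector space `W`: the additive subgroup generated by some basis
of `W` (in particular `W` is finite-dimensional). -/
def IsLatticeIn {W : Type*} [AddCommGroup W] [Module ℝ W] (S : AddSubgroup W) : Prop :=
  ∃ (d : ℕ) (b : Module.Basis (Fin d) ℝ W), S = AddSubgroup.closure (Set.range b)

/-- The smooth manifold `M` is the quotient of the manifold `E` (a normed space) under the action of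
`Γ`, with projection `π`: a surjective local diffeomorphism whose fibres are the orbits of `Γ`. -/
structure IsQuotientManifold (Γ : Type*) [Group Γ] (E : Type*) [NormedAddCommGroup E]
    [NormedSpace ℝ E] [MulAction Γ E] (M : Type*) [TopologicalSpace M] [ChartedSpace E M]
    (π : E → M) : Prop where
  smooth : IsManifold 𝓘(ℝ, E) ∞ M
  hausdorff : T2Space M
  secondCountable : SecondCountableTopology M
  surjective : Function.Surjective π
  localDiffeomorph : IsLocalDiffeomorph 𝓘(ℝ, E) 𝓘(ℝ, E) ∞ π
  fibre_eq_orbit : ∀ x y : E, π x = π y ↔ ∃ g : Γ, y = g • x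

/-- The group `Γ` acts on `E` freely. -/
def ActsFreely (Γ : Type*) [Group Γ] (E : Type*) [MulAction Γ E] : Prop :=
  ∀ (g : Γ) (x : E), g • x = x → g = 1

/-- The (free) action of `Γ` on the normed space `E` by diffeomorphisms is properly discontinuous,
that is, some smooth manifold is its quotient, and the quotient manifold is compact. -/
def IsProperlyDiscontinuousCocompact (Γ : Type*) [Group Γ] (E : Type u) [NormedAddCommGroup E]
    [NormedSpace ℝ E] [MulAction Γ E] : Prop :=
  ∃ (M : Type u) (_ : TopologicalSpace M) (_ : ChartedSpace E M) (π : E → M),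
    IsQuotientManifold Γ E M π ∧ CompactSpace M

namespace ECSData

variable {V : Type u} [NormedAddCommGroup V] [NormedSpace ℝ V]

/-- The space `𝓔` of all smooth solutions `u : ℝ → V` of `ü(t) = f(t) u(t) + A u(t)`. -/
def solutions (D : ECSData V) : Submodule ℝ (ℝ → V) where
  carrier := {u | ContDiff ℝ ∞ u ∧ ∀ t, deriv (deriv u) t = D.f t • u t + D.A (u t)}
  add_mem' := by
    rintro u w ⟨hu, hu'⟩ ⟨hw, hw'⟩
    have h1 : deriv (u + w) = deriv u + deriv w := by
      funext t
      exact deriv_add (hu.differentiable (by simp) t) (hw.differentiable (by simp) t)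
    refine ⟨hu.add hw, fun t => ?_⟩
    have hdu : Differentiable ℝ (deriv u) :=
      (contDiff_infty_iff_deriv.1 hu).2.differentiable (by simp)
    have hdw : Differentiable ℝ (deriv w) :=
      (contDiff_infty_iff_deriv.1 hw).2.differentiable (by simp)
    rw [h1, deriv_add (hdu t) (hdw t), hu', hw']
    simp only [Pi.add_apply, smul_add, map_add]
    abel
  zero_mem' := by
    refine ⟨contDiff_const, fun t => ?_⟩
    have h : deriv (0 : ℝ → V) = 0 := by
      funext t
      exact deriv_const t (0 : V)
    rw [h, h]
    simp
  smul_mem' := by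
    rintro c u ⟨hu, hu'⟩
    have h1 : deriv (c • u) = c • deriv u := by
      funext t
      exact deriv_const_smul c (hu.differentiable (by simp) t)
    refine ⟨hu.const_smul c, fun t => ?_⟩
    have hdu : Differentiable ℝ (deriv u) :=
      (contDiff_infty_iff_deriv.1 hu).2.differentiable (by simp)
    rw [h1, deriv_const_smul c (hdu t), hu']
    simp only [Pi.smul_apply, smul_add, map_smul, smul_comm c]

theorem solutions_differentiable (D : ECSData V) (u : D.solutions) :
    Differentiable ℝ (u : ℝ → V) := u.2.1.differentiable (by simp)

theorem solutions_hasDerivAt (D : ECSData V) (u : D.solutions) (t : ℝ) :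
    HasDerivAt (u : ℝ → V) (deriv (u : ℝ → V) t) t :=
  (D.solutions_differentiable u t).hasDerivAt

theorem solutions_hasDerivAt_deriv (D : ECSData V) (u : D.solutions) (t : ℝ) :
    HasDerivAt (deriv (u : ℝ → V)) (D.f t • (u : ℝ → V) t + D.A ((u : ℝ → V) t)) t := by
  rw [← u.2.2 t]
  exact ((contDiff_infty_iff_deriv.1 u.2.1).2.differentiable (by simp) t).hasDerivAt

theorem solutions_shift_mem (D : ECSData V) (c : ℝ) (hc : ∀ t, D.f (t + c) = D.f t)
    (u : D.solutions) : (fun t => (u : ℝ → V) (t + c)) ∈ D.solutions := by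
  refine ⟨u.2.1.comp (contDiff_id.add contDiff_const), fun t => ?_⟩
  have h1 : deriv (fun t => (u : ℝ → V) (t + c)) = fun t => deriv (u : ℝ → V) (t + c) := by
    funext s
    exact deriv_comp_add_const _ _ _
  rw [h1, deriv_comp_add_const, u.2.2, hc]

/-- The translation operator `T : 𝓔 → 𝓔`, `(T u)(t) = u(t - p)`. -/
def T (D : ECSData V) : D.solutions ≃ₗ[ℝ] D.solutions where
  toFun u := ⟨fun t => (u : ℝ → V) (t - D.p), by
    simpa only [sub_eq_add_neg] using D.solutions_shift_mem (-D.p)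
      (fun t => by simpa only [sub_eq_add_neg] using D.f_periodic.sub_eq t) u⟩
  map_add' _ _ := rfl
  map_smul' _ _ := rfl
  invFun u := ⟨fun t => (u : ℝ → V) (t + D.p), D.solutions_shift_mem D.p D.f_periodic u⟩
  left_inv u := by
    ext t
    simp
  right_inv u := by
    ext t
    simp

theorem T_apply (D : ECSData V) (u : D.solutions) (t : ℝ) :
    (D.T u : ℝ → V) t = (u : ℝ → V) (t - D.p) := rfl

theorem T_inv_apply (D : ECSData V) (u : D.solutions) (t : ℝ) :
    (D.T⁻¹ u : ℝ → V) t = (u : ℝ → V) (t + D.p) := rfl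

theorem T_zpow_apply (D : ECSData V) (k : ℤ) (u : D.solutions) (t : ℝ) :
    ((D.T ^ k) u : ℝ → V) t = (u : ℝ → V) (t - k * D.p) := by
  induction k generalizing t with
  | zero => simp
  | succ i ih =>
    rw [zpow_add_one, LinearEquiv.mul_apply, ← LinearEquiv.mul_apply, ← zpow_add_one, add_comm,
      zpow_one_add, LinearEquiv.mul_apply, T_apply, ih]
    push_cast
    ring_nf
  | pred i ih =>
    rw [sub_eq_add_neg, add_comm, zpow_add, zpow_neg_one, LinearEquiv.mul_apply, T_inv_apply, ih]
    push_cast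
    ring_nf

theorem deriv_T_zpow (D : ECSData V) (k : ℤ) (u : D.solutions) (t : ℝ) :
    deriv ((D.T ^ k) u : ℝ → V) t = deriv (u : ℝ → V) (t - k * D.p) := by
  have h : ((D.T ^ k) u : ℝ → V) = fun s => (u : ℝ → V) (s - k * D.p) := by
    funext s
    exact D.T_zpow_apply k u s
  rw [h, deriv_comp_sub_const]

/-- The function `⟨u̇, w⟩ - ⟨u, ẇ⟩` of the variable `t`. -/
noncomputable def wronskian (D : ECSData V) (u w : ℝ → V) (t : ℝ) : ℝ :=
  D.ip (deriv u t) (w t) - D.ip (u t) (deriv w t)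

theorem finiteDimensional (D : ECSData V) : FiniteDimensional ℝ V :=
  Module.finite_of_finrank_pos (by have := D.four_le_n; have := D.finrank_add_two; omega)

theorem wronskian_const (D : ECSData V) (u w : D.solutions) (t s : ℝ) :
    D.wronskian u w t = D.wronskian u w s := by
  have := D.finiteDimensional
  have key : ∀ x, HasDerivAt (D.wronskian u w) 0 x := by
    intro x
    have h1 := (D.ip.toContinuousBilinearMap).hasDerivAt_of_bilinear
      (fun _ => D.solutions_hasDerivAt_deriv u x) (fun _ => D.solutions_hasDerivAt w x)
    have h2 := (D.ip.toContinuousBilinearMap).hasDerivAt_of_bilinear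
      (fun _ => D.solutions_hasDerivAt u x) (fun _ => D.solutions_hasDerivAt_deriv w x)
    have h3 := h1.sub h2
    refine h3.congr_deriv ?_
    simp only [LinearMap.toContinuousBilinearMap_apply]
    simp only [map_add, map_smul, LinearMap.add_apply, LinearMap.smul_apply, D.A_selfAdjoint,
      smul_eq_mul]
    ring
  exact is_const_of_deriv_eq_zero (fun x => (key x).differentiableAt) (fun x => (key x).deriv) t s

/-- The skew-symmetric form `Ω(u, w) = ⟨u̇, w⟩ - ⟨u, ẇ⟩` on `𝓔`; the right-hand side does not depend
on `t` (see `Omega_eq`) and is evaluated here at `t = 0`. -/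
noncomputable def Omega (D : ECSData V) (u w : D.solutions) : ℝ := D.wronskian u w 0

theorem Omega_eq (D : ECSData V) (u w : D.solutions) (t : ℝ) :
    D.Omega u w = D.ip (deriv (u : ℝ → V) t) ((w : ℝ → V) t)
      - D.ip ((u : ℝ → V) t) (deriv (w : ℝ → V) t) :=
  D.wronskian_const u w 0 t

theorem deriv_add_apply (D : ECSData V) (u w : D.solutions) (t : ℝ) :
    deriv ((u : ℝ → V) + (w : ℝ → V)) t = deriv (u : ℝ → V) t + deriv (w : ℝ → V) t :=
  deriv_add (D.solutions_differentiable u t) (D.solutions_differentiable w t)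

theorem deriv_zero_apply (D : ECSData V) (t : ℝ) :
    deriv ((0 : D.solutions) : ℝ → V) t = 0 :=
  deriv_const t (0 : V)

theorem Omega_add_left (D : ECSData V) (u u' w : D.solutions) :
    D.Omega (u + u') w = D.Omega u w + D.Omega u' w := by
  simp only [D.Omega_eq _ _ 0, deriv_add_apply, Submodule.coe_add, Pi.add_apply, map_add,
    LinearMap.add_apply]
  ring

theorem Omega_add_right (D : ECSData V) (u w w' : D.solutions) :
    D.Omega u (w + w') = D.Omega u w + D.Omega u w' := by
  simp only [D.Omega_eq _ _ 0, deriv_add_apply, Submodule.coe_add, Pi.add_apply, map_add]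
  ring

theorem Omega_zero_left (D : ECSData V) (w : D.solutions) : D.Omega 0 w = 0 := by
  have h := D.Omega_add_left 0 0 w
  rw [add_zero] at h
  linarith

theorem Omega_zero_right (D : ECSData V) (u : D.solutions) : D.Omega u 0 = 0 := by
  have h := D.Omega_add_right u 0 0
  rw [add_zero] at h
  linarith

theorem Omega_self (D : ECSData V) (u : D.solutions) : D.Omega u u = 0 := by
  rw [D.Omega_eq u u 0, D.ip_symm.eq, sub_self]

theorem Omega_neg_left (D : ECSData V) (u w : D.solutions) :
    D.Omega (-u) w = -D.Omega u w := by
  have h := D.Omega_add_left u (-u) w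
  rw [add_neg_cancel, Omega_zero_left] at h
  linarith

theorem Omega_T_zpow (D : ECSData V) (k : ℤ) (u w : D.solutions) :
    D.Omega ((D.T ^ k) u) ((D.T ^ k) w) = D.Omega u w := by
  rw [D.Omega_eq _ _ 0, D.Omega_eq u w (0 - k * D.p)]
  simp only [T_zpow_apply, deriv_T_zpow]

theorem Omega_T_neg (D : ECSData V) (k : ℤ) (u w : D.solutions) :
    D.Omega ((D.T ^ (-k)) u) w = D.Omega u ((D.T ^ k) w) := by
  rw [← D.Omega_T_zpow k, ← LinearEquiv.mul_apply, ← zpow_add, add_neg_cancel, zpow_zero,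
    LinearEquiv.coe_one, id]

theorem T_zpow_add (D : ECSData V) (k l : ℤ) (u : D.solutions) :
    (D.T ^ (k + l)) u = (D.T ^ k) ((D.T ^ l) u) := by
  rw [zpow_add, LinearEquiv.mul_apply]

/-- The underlying set `ℤ × ℝ × 𝓔` of the group `G`. -/
@[ext]
structure G (D : ECSData V) where
  /-- the integer component -/
  k : ℤ
  /-- the real component -/
  q : ℝ
  /-- the component in the solution space -/
  u : D.solutions

/-- The group operation `(k, q, u) · (l, r, w) = (k + l, q + r - Ω(u, Tˡ w), T⁻ˡ u + w)`. -/
noncomputable instance (D : ECSData V) : Mul D.G where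
  mul g h := ⟨g.k + h.k, g.q + h.q - D.Omega g.u ((D.T ^ h.k) h.u), (D.T ^ (-h.k)) g.u + h.u⟩

noncomputable instance (D : ECSData V) : One D.G where
  one := ⟨0, 0, 0⟩

noncomputable instance (D : ECSData V) : Inv D.G where
  inv g := ⟨-g.k, -g.q, -((D.T ^ g.k) g.u)⟩

theorem mul_def (D : ECSData V) (g h : D.G) : g * h =
    ⟨g.k + h.k, g.q + h.q - D.Omega g.u ((D.T ^ h.k) h.u), (D.T ^ (-h.k)) g.u + h.u⟩ := rfl

theorem one_def (D : ECSData V) : (1 : D.G) = ⟨0, 0, 0⟩ := rfl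

theorem inv_def (D : ECSData V) (g : D.G) : g⁻¹ = ⟨-g.k, -g.q, -((D.T ^ g.k) g.u)⟩ := rfl

noncomputable instance (D : ECSData V) : Group D.G :=
  Group.ofLeftAxioms
    (by
      intro a b c
      have h : D.Omega ((D.T ^ (-b.k)) a.u) ((D.T ^ c.k) c.u)
          = D.Omega a.u ((D.T ^ (b.k + c.k)) c.u) := by
        rw [Omega_T_neg, T_zpow_add]
      have h2 : D.Omega a.u ((D.T ^ (b.k + c.k)) ((D.T ^ (-c.k)) b.u))
          = D.Omega a.u ((D.T ^ b.k) b.u) := by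
        rw [← T_zpow_add, add_neg_cancel_right]
      simp only [mul_def, G.mk.injEq]
      refine ⟨add_assoc _ _ _, ?_, ?_⟩
      · rw [map_add, Omega_add_right, Omega_add_left, h, h2]
        ring
      · rw [map_add, ← T_zpow_add, neg_add_rev, add_assoc])
    (by
      intro a
      simp only [mul_def, one_def, Omega_zero_left, map_zero, zero_add, sub_zero])
    (by
      intro a
      have h : D.Omega ((D.T ^ a.k) a.u) ((D.T ^ a.k) a.u) = 0 := D.Omega_self _
      simp only [mul_def, inv_def, one_def, Omega_neg_left, h, map_neg,
        ← T_zpow_add, neg_add_cancel, zpow_zero, LinearEquiv.coe_one, id, neg_zero, sub_zero])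

/-- The manifold `M̂ = ℝ² × V`, with points `(t, s, v)`. -/
abbrev MHat (_ : ECSData V) : Type u := ℝ × ℝ × V

/-- The action `(k, q, u) · (t, s, v) = (t + k p, s + q - ⟨u̇(t), 2 v + u(t)⟩, v + u(t))`. -/
noncomputable instance (D : ECSData V) : MulAction D.G D.MHat where
  smul g x := (x.1 + g.k * D.p,
    x.2.1 + g.q - D.ip (deriv (g.u : ℝ → V) x.1) ((2 : ℝ) • x.2.2 + (g.u : ℝ → V) x.1),
    x.2.2 + (g.u : ℝ → V) x.1)
  one_smul x := by
    change ((x.1 + ((0 : ℤ) : ℝ) * D.p, x.2.1 + 0 - D.ip (deriv ((0 : D.solutions) : ℝ → V) x.1)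
      ((2 : ℝ) • x.2.2 + ((0 : D.solutions) : ℝ → V) x.1),
      x.2.2 + ((0 : D.solutions) : ℝ → V) x.1) : D.MHat) = x
    rw [deriv_zero_apply]
    simp
  mul_smul g h x := by
    obtain ⟨t, s, v⟩ := x
    have e := D.Omega_T_neg h.k g.u h.u
    rw [D.Omega_eq _ _ t] at e
    simp only [T_zpow_apply, deriv_T_zpow] at e
    change ((t + (g * h).k * D.p,
      s + (g * h).q - D.ip (deriv ((g * h).u : ℝ → V) t) ((2 : ℝ) • v + ((g * h).u : ℝ → V) t),
      v + ((g * h).u : ℝ → V) t) : D.MHat) =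
      (t + h.k * D.p + g.k * D.p,
      s + h.q - D.ip (deriv (h.u : ℝ → V) t) ((2 : ℝ) • v + (h.u : ℝ → V) t) + g.q
        - D.ip (deriv (g.u : ℝ → V) (t + h.k * D.p)) ((2 : ℝ) • (v + (h.u : ℝ → V) t)
          + (g.u : ℝ → V) (t + h.k * D.p)),
      v + (h.u : ℝ → V) t + (g.u : ℝ → V) (t + h.k * D.p))
    simp only [mul_def, deriv_add_apply, deriv_T_zpow, Submodule.coe_add, Pi.add_apply,
      T_zpow_apply, Prod.mk.injEq, ← e]
    push_cast
    simp only [neg_mul, sub_neg_eq_add]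
    have e2 := D.ip_symm.eq ((g.u : ℝ → V) (t + h.k * D.p)) (deriv (h.u : ℝ → V) t)
    refine ⟨by ring, ?_, by abel⟩
    simp only [map_add, map_smul, LinearMap.add_apply, smul_eq_mul, e2]
    ring

/-- The homomorphism `Π : G → ℤ`, `Π(k, q, u) = k`. -/
noncomputable def Pi (D : ECSData V) : D.G →* Multiplicative ℤ where
  toFun g := Multiplicative.ofAdd g.k
  map_one' := rfl
  map_mul' _ _ := rfl

/-- The space `𝓛` of all solutions `u : ℝ → V` of `u̇(t) = B(t) u(t)`. -/
def firstOrderSolutions (B : ℝ → V →L[ℝ] V) : Submodule ℝ (ℝ → V) where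
  carrier := {u | ∀ t, HasDerivAt u (B t (u t)) t}
  add_mem' := by
    intro u w hu hw t
    simpa using (hu t).add (hw t)
  zero_mem' := by
    intro t
    simp only [Pi.zero_apply, map_zero]
    exact hasDerivAt_const t (0 : V)
  smul_mem' := by
    intro c u hu t
    simpa using (hu t).const_smul c

/-- The translation operator `T : 𝓛 → 𝓛`, `(T w)(t) = w(t - p)`, for `B` of period `p`. -/
def translation {B : ℝ → V →L[ℝ] V} {p : ℝ} (hB : Function.Periodic B p) :
    firstOrderSolutions B →ₗ[ℝ] firstOrderSolutions B where
  toFun w := ⟨fun t => (w : ℝ → V) (t - p), fun t => by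
    have h := (w.2 (t - p)).comp_sub_const t p
    rwa [hB.sub_eq] at h⟩
  map_add' _ _ := rfl
  map_smul' _ _ := rfl

/-- The operator `Ψ(r, w) = (r + φ(w), T w)` in `𝓦 = ℝ × 𝓛`. -/
def Psi {B : ℝ → V →L[ℝ] V} {p : ℝ} (hB : Function.Periodic B p)
    (φ : Module.Dual ℝ (firstOrderSolutions B)) (x : ℝ × firstOrderSolutions B) :
    ℝ × firstOrderSolutions B :=
  (x.1 + φ x.2, translation hB x.2)

end ECSData

/-! Elements `(0, q, u)` of `G` multiply as in a Heisenberg group with cocycle `-Ω`, and preserve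
every slice of constant `t`. Since `Π(Γ) = ℤ`, the group `Γ` is the extension of its kernel part,
the elements with `k = 0`, by the powers of one element `γ` with `k = 1`.

From `Γ` to the lattice: the quotient makes the kernel part act properly on each slice, and, because
powers of `γ` undo bounded shifts of `t`, also cocompactly. Its intersection with the center is
discrete, hence `2θℤ`, and commutators give `2Ω(u, w) ∈ 2θℤ`. Let `L₀` be the span of the
`𝓔`-components of the kernel part. Cocompactness makes each evaluation `u ↦ u(t)` map `L₀` onto `V`.
It is also injective: if `θ > 0`, the central part lets `q` be adjusted, so the components evaluate
to a discrete set; if `θ = 0`, then `Ω` vanishes on `L₀`, and `u(t) = 0` makes `u̇(t)` orthogonal to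
all of `V` (`eq_zero_of_mem_span_kernelImage`). Hence `u̇ = B u` on `L₀` for one operator function
`B`. It solves the Riccati equation because `L₀ ⊂ 𝓔`, and is periodic because `T` preserves `L₀`.
Adding `ℤθ` to the pairs `(q, u)` absorbs the cocycle and yields the lattice
(`isLatticeIn_kernelLattice`); conjugation by `γ` becomes `Ψ`.

Back: condition c) makes the lattice a subgroup of the Heisenberg group. For `u₀` with `-2Ω(u₀, ·) =
φ` on `𝓛`, condition b) says that `(1, 0, u₀)` normalizes it, and the two generate `Γ`.
Cocompactness (`exists_ofFirstOrder_smul_norm_le`) follows from the substitution `(s, v) ↦ (s + ⟨Bv,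
v⟩, v)`, which turns the action on a slice into translations up to an `Ω`-term that `θ` absorbs. -/

/-! ### Linear differential equations: uniqueness, smoothness, global existence -/

section LinearODE

variable {E : Type*} [NormedAddCommGroup E] [NormedSpace ℝ E]

theorem linearODE_eq_zero {M : ℝ → E →L[ℝ] E} (hM : Continuous M) {y : ℝ → E}
    (hy : ∀ t, HasDerivAt y (M t (y t)) t) {t₀ : ℝ} (h₀ : y t₀ = 0) (t : ℝ) : y t = 0 := by
  obtain ⟨a, ha⟩ : ∃ a, a < min t₀ t := exists_lt _
  obtain ⟨b, hb⟩ : ∃ b, max t₀ t < b := exists_gt _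
  rw [lt_min_iff] at ha
  rw [max_lt_iff] at hb
  obtain ⟨K, hK⟩ := (isCompact_Icc (a := a) (b := b)).exists_bound_of_continuousOn hM.continuousOn
  have key := ODE_solution_unique_of_mem_Ioo (v := fun s x => M s x) (s := fun _ => Set.univ)
    (K := K.toNNReal) (a := a) (b := b) (t₀ := t₀) (f := y) (g := fun _ => 0)
    (fun s hs => by
      refine ((M s).lipschitz.weaken ?_).lipschitzOnWith
      exact NNReal.coe_le_coe.1
        ((hK s (Set.Ioo_subset_Icc_self hs)).trans (Real.le_coe_toNNReal K)))
    ⟨ha.1, hb.1⟩ (fun s _ => ⟨hy s, trivial⟩)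
    (fun s _ => ⟨by simpa using hasDerivAt_const s (0 : E), trivial⟩) h₀
  exact key ⟨ha.2, hb.2⟩

theorem contDiff_of_linearODE {M : ℝ → E →L[ℝ] E} (hM : ContDiff ℝ ∞ M) {y : ℝ → E}
    (hy : ∀ t, HasDerivAt y (M t (y t)) t) : ContDiff ℝ ∞ y := by
  have hd : deriv y = fun t => M t (y t) := funext fun t => (hy t).deriv
  refine contDiff_infty.2 fun n => ?_
  induction n with
  | zero => exact contDiff_zero.2 (continuous_iff_continuousAt.2 fun t => (hy t).continuousAt)
  | succ n ih =>
    push_cast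
    rw [contDiff_succ_iff_deriv]
    refine ⟨fun t => (hy t).differentiableAt, by simp, ?_⟩
    rw [hd]
    exact (hM.of_le (by exact_mod_cast le_top)).clm_apply ih

/-- The terms of the Picard series of the linear equation `ẏ = M y`. -/
noncomputable def picardTerm (M : ℝ → E →L[ℝ] E) (y₀ : E) : ℕ → ℝ → E
  | 0 => fun _ => y₀
  | n + 1 => fun t => ∫ s in (0 : ℝ)..t, M s (picardTerm M y₀ n s)

theorem continuous_picardTerm {M : ℝ → E →L[ℝ] E} (hM : Continuous M) (y₀ : E) (n : ℕ) :
    Continuous (picardTerm M y₀ n) := by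
  induction n with
  | zero => exact continuous_const
  | succ n ih =>
    exact intervalIntegral.continuous_primitive
      (fun a b => (hM.clm_apply ih).intervalIntegrable a b) 0

theorem hasDerivAt_picardTerm_succ [CompleteSpace E] {M : ℝ → E →L[ℝ] E} (hM : Continuous M)
    (y₀ : E) (n : ℕ) (t : ℝ) :
    HasDerivAt (picardTerm M y₀ (n + 1)) (M t (picardTerm M y₀ n t)) t := by
  have h := hM.clm_apply (continuous_picardTerm hM y₀ n)
  exact intervalIntegral.integral_hasDerivAt_right (h.intervalIntegrable _ _)
    (h.stronglyMeasurableAtFilter _ _) h.continuousAt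

/-- Integrating `|s| ^ n` at each stage produces the factorial, so the Picard series converges on an
interval of any length. -/
theorem norm_picardTerm_le {M : ℝ → E →L[ℝ] E} (hM : Continuous M) (y₀ : E) {C R : ℝ}
    (hC : ∀ t ∈ Set.Icc (-R) R, ‖M t‖ ≤ C) (n : ℕ) {t : ℝ} (ht : |t| ≤ R) :
    ‖picardTerm M y₀ n t‖ ≤ ‖y₀‖ * ((C * |t|) ^ n / n.factorial) := by
  have hR : 0 ≤ R := (abs_nonneg t).trans ht
  have hC0 : 0 ≤ C := (norm_nonneg _).trans (hC 0 ⟨by linarith, hR⟩)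
  induction n generalizing t with
  | zero => simp [picardTerm]
  | succ n ih =>
    have h := hM.clm_apply (continuous_picardTerm hM y₀ n)
    calc ‖picardTerm M y₀ (n + 1) t‖
        ≤ ∫ s in Set.uIoc 0 t, ‖M s (picardTerm M y₀ n s)‖ :=
          intervalIntegral.norm_integral_le_integral_norm_uIoc
      _ ≤ ∫ s in Set.uIoc 0 t, ‖y₀‖ * C ^ (n + 1) / n.factorial * |s - 0| ^ n := by
          refine MeasureTheory.setIntegral_mono_on ?_ ?_ measurableSet_uIoc ?_
          · exact (intervalIntegrable_iff.1 (h.norm.intervalIntegrable 0 t))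
          · exact (intervalIntegrable_iff.1
              (Continuous.intervalIntegrable (by fun_prop) 0 t))
          · intro s hs
            have hst : |s| ≤ |t| := by
              have := Set.abs_sub_left_of_mem_uIcc (Set.uIoc_subset_uIcc hs)
              simpa using this
            have hsR : |s| ≤ R := hst.trans ht
            calc ‖M s (picardTerm M y₀ n s)‖ ≤ ‖M s‖ * ‖picardTerm M y₀ n s‖ := (M s).le_opNorm _
              _ ≤ C * (‖y₀‖ * ((C * |s|) ^ n / n.factorial)) :=
                  mul_le_mul (hC s (abs_le.1 hsR)) (ih hsR) (norm_nonneg _) hC0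
              _ = ‖y₀‖ * C ^ (n + 1) / n.factorial * |s - 0| ^ n := by
                  rw [sub_zero]; ring
      _ = ‖y₀‖ * ((C * |t|) ^ (n + 1) / (n + 1).factorial) := by
          rw [MeasureTheory.integral_const_mul, integral_pow_abs_sub_uIoc, sub_zero,
            Nat.factorial_succ]
          push_cast
          field_simp
          ring

/-- The derivative of each Picard term is `M` applied to the preceding one, so termwise
differentiation of the series gives the equation. The factorial bounds justify it on every ball,
which makes the solution global. -/
theorem exists_linearODE_solution [CompleteSpace E] {M : ℝ → E →L[ℝ] E} (hM : Continuous M)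
    (y₀ : E) : ∃ y : ℝ → E, y 0 = y₀ ∧ ∀ t, HasDerivAt y (M t (y t)) t := by
  refine ⟨fun t => ∑' n, picardTerm M y₀ n t, ?_, fun t => ?_⟩
  · change ∑' n, picardTerm M y₀ n 0 = y₀
    rw [tsum_eq_single 0]
    · rfl
    · rintro (_ | n) hn
      · exact absurd rfl hn
      · simp [picardTerm]
  · set R := |t| + 1
    obtain ⟨C, hC⟩ := (isCompact_Icc (a := -R) (b := R)).exists_bound_of_continuousOn
      hM.continuousOn
    have hR : 0 < R := by positivity
    have hC0 : 0 ≤ C := (norm_nonneg _).trans (hC 0 ⟨by linarith, hR.le⟩)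
    have hbd : ∀ n, ∀ s ∈ Metric.ball (0 : ℝ) R,
        ‖picardTerm M y₀ n s‖ ≤ ‖y₀‖ * ((C * R) ^ n / n.factorial) := by
      intro n s hs
      have hs' : |s| ≤ R := by simpa using (Metric.mem_ball.1 hs).le
      refine (norm_picardTerm_le hM y₀ hC n hs').trans ?_
      gcongr
    have hsum : Summable fun n : ℕ => ‖y₀‖ * ((C * R) ^ n / n.factorial) :=
      (Real.summable_pow_div_factorial (C * R)).mul_left _
    have ht : t ∈ Metric.ball (0 : ℝ) R := by simp [R]
    let g' : ℕ → ℝ → E := fun n s => match n with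
      | 0 => 0
      | k + 1 => M s (picardTerm M y₀ k s)
    let b : ℕ → ℝ := fun n => match n with
      | 0 => 0
      | k + 1 => C * (‖y₀‖ * ((C * R) ^ k / k.factorial))
    have hb : Summable b := (summable_nat_add_iff 1).1 (hsum.mul_left C)
    have key := hasDerivAt_tsum_of_isPreconnected (g := picardTerm M y₀) (g' := g') (u := b)
      hb Metric.isOpen_ball (convex_ball (0 : ℝ) R).isPreconnected
      (by
        rintro (_ | n) s hs
        · exact hasDerivAt_const s y₀
        · exact hasDerivAt_picardTerm_succ hM y₀ n s)
      (by
        rintro (_ | n) s hs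
        · simp [g', b]
        · have hs' : |s| ≤ R := by simpa using (Metric.mem_ball.1 hs).le
          exact ((M s).le_opNorm _).trans
            (mul_le_mul (hC s (abs_le.1 hs')) (hbd n s hs) (norm_nonneg _) hC0))
      ht (Summable.of_norm_bounded hsum fun n => hbd n t ht) ht
    have hs1 : Summable fun n => picardTerm M y₀ n t :=
      Summable.of_norm_bounded hsum fun n => hbd n t ht
    convert key using 1
    rw [(M t).map_tsum hs1]
    have hs2 : Summable fun n => g' n t := by
      rw [← summable_nat_add_iff 1]
      exact (M t).summable hs1
    rw [hs2.tsum_eq_zero_add]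
    simp [g']

end LinearODE

/-! ### Quotient manifolds: construction and consequences -/

section QuotientManifold

variable {Γ : Type*} [Group Γ] {E : Type u} [NormedAddCommGroup E] [NormedSpace ℝ E]
  [MulAction Γ E]

/-- The charts inverse to a surjective local homeomorphism from a normed space. -/
@[reducible]
noncomputable def inverseChartedSpace {Q : Type*} [TopologicalSpace Q] {f : E → Q}
    (hf : IsLocalHomeomorph f) (hs : Function.Surjective f) : ChartedSpace E Q where
  atlas := {e | ⇑e.symm = f}
  chartAt q := hf.localInverseAt (hs q).choose
  mem_chart_source q := by
    have h := hf.apply_self_mem_localInverseAt_source (x := (hs q).choose)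
    rwa [(hs q).choose_spec] at h
  chart_mem_atlas q := hf.localInverseAt_symm _

theorem isQuotientManifold_inverseChartedSpace {Q : Type*} [TopologicalSpace Q] [T2Space Q]
    [SecondCountableTopology Q] {f : E → Q} (hf : IsLocalHomeomorph f)
    (hs : Function.Surjective f) (hfib : ∀ x y : E, f x = f y ↔ ∃ g : Γ, y = g • x)
    (hsm : ∀ g : Γ, ContDiff ℝ ∞ fun x : E => g • x) :
    letI := inverseChartedSpace hf hs
    IsQuotientManifold Γ E Q f := by
  let := inverseChartedSpace hf hs
  have hman : IsManifold 𝓘(ℝ, E) ∞ Q := by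
    refine isManifold_of_contDiffOn _ _ _ fun e e' he he' => ?_
    have he : ⇑e.symm = f := he
    have he' : ⇑e'.symm = f := he'
    intro x hx
    simp only [modelWithCornersSelf_coe_symm, modelWithCornersSelf_coe, Set.range_id,
      Set.preimage_id, Set.inter_univ, OpenPartialHomeomorph.trans_source,
      OpenPartialHomeomorph.symm_source, Set.mem_inter_iff, Set.mem_preimage, he] at hx
    -- Two local inverses of `f` differ at `x` by some `g`. By continuity the same `g` serves
    -- nearby, so the transition map is locally the smooth map `g • ·`.
    obtain ⟨g, hg⟩ := (hfib x (e' (f x))).1 (by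
      rw [← he', e'.left_inv (by rw [he']; exact hx.2)])
    refine ContDiffAt.contDiffWithinAt ?_
    refine ((hsm g).contDiffAt).congr_of_eventuallyEq ?_
    have h1 : ∀ᶠ y in nhds x, f y ∈ e'.source :=
      hf.continuous.continuousAt (e'.open_source.mem_nhds hx.2)
    have h2 : ∀ᶠ y in nhds x, g • y ∈ e'.target := by
      refine (hsm g).continuous.continuousAt (e'.open_target.mem_nhds ?_)
      rw [← hg]
      exact e'.map_source hx.2
    filter_upwards [h1, h2] with y hy1 hy2
    have h3 : f y = e'.symm (g • y) := by
      rw [he']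
      exact (hfib _ _).2 ⟨g, rfl⟩
    simp only [modelWithCornersSelf_coe_symm, modelWithCornersSelf_coe, id_eq, Function.comp_apply,
      OpenPartialHomeomorph.coe_trans, he]
    rw [h3, e'.right_inv hy2]
  refine ⟨hman, inferInstance, inferInstance, hs, fun x => ?_, hfib⟩
  set e := hf.localInverseAt x with he
  have hsymm : ⇑e.symm = f := hf.localInverseAt_symm x
  have hmem : e ∈ IsManifold.maximalAtlas 𝓘(ℝ, E) ∞ Q :=
    IsManifold.subset_maximalAtlas (show e ∈ atlas E Q from hsymm)
  refine ⟨{ toPartialEquiv := e.symm.toPartialEquiv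
            open_source := e.open_target
            open_target := e.open_source
            contMDiffOn_toFun := contMDiffOn_symm_of_mem_maximalAtlas hmem
            contMDiffOn_invFun := contMDiffOn_of_mem_maximalAtlas hmem }, ?_, ?_⟩
  · exact hf.self_mem_localInverseAt_target
  · intro y _
    exact (congrFun hsymm y).symm

theorem isProperlyDiscontinuousCocompact_of_finite [FiniteDimensional ℝ E]
    (hsm : ∀ g : Γ, ContDiff ℝ ∞ fun x : E => g • x) (hfree : ActsFreely Γ E)
    (hpd : ∀ K : Set E, IsCompact K → {g : Γ | ∃ x ∈ K, g • x ∈ K}.Finite)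
    (hco : ∃ K : Set E, IsCompact K ∧ ∀ x : E, ∃ g : Γ, g • x ∈ K) :
    IsProperlyDiscontinuousCocompact Γ E := by
  have : ProperSpace E := FiniteDimensional.proper_real E
  have : ContinuousConstSMul Γ E := ⟨fun g => (hsm g).continuous⟩
  have : ProperlyDiscontinuousSMul Γ E := ⟨fun {K L} hK hL => by
    refine (hpd (K ∪ L) (hK.union hL)).subset ?_
    rintro g ⟨_, ⟨x, hx, rfl⟩, hy⟩
    exact ⟨x, Or.inl hx, Or.inr hy⟩⟩
  have : IsCancelSMul Γ E := isCancelSMul_iff_eq_one_of_smul_eq.2 hfree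
  let π : E → MulAction.orbitRel.Quotient Γ E := Quotient.mk (MulAction.orbitRel Γ E)
  have hcov := isQuotientCoveringMap_quotientMk_of_properlyDiscontinuousSMul (E := E) (G := Γ)
  have hloc : IsLocalHomeomorph π := hcov.isCoveringMap.isLocalHomeomorph
  have hs : Function.Surjective π := Quotient.mk_surjective
  have hsec : SecondCountableTopology (MulAction.orbitRel.Quotient Γ E) :=
    ContinuousConstSMul.secondCountableTopology
  have ht2 : T2Space (MulAction.orbitRel.Quotient Γ E) :=
    t2Space_of_properlyDiscontinuousSMul_of_t2Space
  have hfib : ∀ x y : E, π x = π y ↔ ∃ g : Γ, y = g • x := by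
    intro x y
    rw [eq_comm]
    refine Quotient.eq''.trans ?_
    change y ∈ MulAction.orbit Γ x ↔ _
    simp only [MulAction.mem_orbit_iff, eq_comm]
  refine ⟨MulAction.orbitRel.Quotient Γ E, inferInstance, inverseChartedSpace hloc hs, π,
    isQuotientManifold_inverseChartedSpace hloc hs hfib hsm, ?_⟩
  obtain ⟨K, hK, hcover⟩ := hco
  have himg : π '' K = Set.univ := by
    refine Set.eq_univ_of_forall fun q => ?_
    obtain ⟨x, rfl⟩ := hs q
    obtain ⟨g, hg⟩ := hcover x
    exact ⟨g • x, hg, ((hfib _ _).2 ⟨g, rfl⟩).symm⟩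
  exact ⟨himg ▸ hK.image hloc.continuous⟩

/-- The fibre of `π` through `x` is closed, as `M` is Hausdorff, and discrete, as `π` is locally
injective; it therefore meets `K` in a finite set. Freeness passes from points of the orbit to group
elements. -/
theorem IsQuotientManifold.finite_of_smul_mem {M : Type*} [TopologicalSpace M] [ChartedSpace E M]
    {π : E → M} (h : IsQuotientManifold Γ E M π) (hfree : ActsFreely Γ E) (x : E) {K : Set E}
    (hK : IsCompact K) : {g : Γ | g • x ∈ K}.Finite := by
  have hloc : IsLocalHomeomorph π := h.localDiffeomorph.isLocalHomeomorph
  have : T2Space M := h.hausdorff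
  have hcl : IsClosed (π ⁻¹' {π x}) := isClosed_singleton.preimage hloc.continuous
  have hfin : (K ∩ π ⁻¹' {π x}).Finite := by
    refine (hK.inter_right hcl).finite ?_
    rw [isDiscrete_iff_forall_mem_exists_isOpen]
    rintro y ⟨hyK, hy⟩
    obtain ⟨U, hU, hyU, hinj⟩ := hloc.isLocallyInjective y
    refine ⟨U, hU, ?_⟩
    refine Set.Subset.antisymm ?_ ?_
    · rintro z ⟨hzU, -, hz⟩
      exact hinj hzU hyU (hz.trans hy.symm)
    · rintro _ rfl
      exact ⟨hyU, hyK, hy⟩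
  refine Set.Finite.of_finite_image (f := fun g : Γ => g • x) (hfin.subset ?_) ?_
  · rintro _ ⟨g, hg, rfl⟩
    exact ⟨hg, ((h.fibre_eq_orbit _ _).2 ⟨g, rfl⟩).symm⟩
  · intro a _ b _ hab
    have := hfree (b⁻¹ * a) x (by
      rw [mul_smul]
      have hab : a • x = b • x := hab
      rw [hab, inv_smul_smul])
    exact (inv_mul_eq_one.1 this).symm

theorem IsQuotientManifold.exists_compact_cover [FiniteDimensional ℝ E] {M : Type*}
    [TopologicalSpace M] [ChartedSpace E M] [CompactSpace M] {π : E → M}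
    (h : IsQuotientManifold Γ E M π) : ∃ R : ℝ, ∀ x : E, ∃ g : Γ, ‖g • x‖ ≤ R := by
  have hloc : IsLocalHomeomorph π := h.localDiffeomorph.isLocalHomeomorph
  obtain ⟨n, hn⟩ := isCompact_univ.elim_directed_cover (fun n : ℕ => π '' Metric.ball 0 n)
    (fun n => hloc.isOpenMap _ Metric.isOpen_ball)
    (fun q _ => by
      obtain ⟨x, rfl⟩ := h.surjective q
      obtain ⟨n, hn⟩ := exists_nat_gt ‖x‖
      exact Set.mem_iUnion.2 ⟨n, x, by simpa using hn, rfl⟩)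
    (directed_of_isDirected_le fun m n hmn =>
      Set.image_mono (Metric.ball_subset_ball (by exact_mod_cast hmn)))
  refine ⟨n, fun x => ?_⟩
  obtain ⟨y, hy, hxy⟩ := hn (Set.mem_univ (π x))
  obtain ⟨g, rfl⟩ := (h.fibre_eq_orbit x y).1 hxy.symm
  exact ⟨g, by simpa using (Metric.mem_ball.1 hy).le⟩

end QuotientManifold

/-! ### Lattices and discrete subgroups -/

section Lattice

variable {W W' : Type*}

theorem IsLatticeIn.map [AddCommGroup W] [Module ℝ W] [AddCommGroup W'] [Module ℝ W']
    {S : AddSubgroup W} (h : IsLatticeIn S) (e : W ≃ₗ[ℝ] W') :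
    IsLatticeIn (S.map e.toLinearMap.toAddMonoidHom) := by
  obtain ⟨d, b, rfl⟩ := h
  refine ⟨d, b.map e, ?_⟩
  rw [AddMonoidHom.map_closure, ← Set.range_comp]
  congr 1

theorem IsLatticeIn.span_eq_top [AddCommGroup W] [Module ℝ W] {S : AddSubgroup W}
    (h : IsLatticeIn S) : Submodule.span ℝ (S : Set W) = ⊤ := by
  obtain ⟨d, b, rfl⟩ := h
  rw [eq_top_iff, ← b.span_eq]
  exact Submodule.span_mono AddSubgroup.subset_closure

variable [NormedAddCommGroup W] [NormedSpace ℝ W]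

theorem isLatticeIn_of_finite [FiniteDimensional ℝ W] {S : AddSubgroup W}
    (hfin : ∀ R : ℝ, {x : W | x ∈ S ∧ ‖x‖ ≤ R}.Finite)
    (hspan : Submodule.span ℝ (S : Set W) = ⊤) : IsLatticeIn S := by
  let L : Submodule ℤ W := AddSubgroup.toIntSubmodule S
  have hdisc : DiscreteTopology L := by
    rw [← SetLike.isDiscrete_iff_discreteTopology, isDiscrete_iff_forall_mem_exists_isOpen]
    intro y hy
    have hF := (hfin (‖y‖ + 1)).subset (Set.sdiff_subset (t := {y}))
    refine ⟨Metric.ball y 1 ∩ ({x | x ∈ S ∧ ‖x‖ ≤ ‖y‖ + 1} \ {y})ᶜ,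
      Metric.isOpen_ball.inter hF.isClosed.isOpen_compl, ?_⟩
    refine Set.Subset.antisymm ?_ ?_
    · rintro x ⟨⟨hx1, hx2⟩, hxS⟩
      by_contra hne
      refine hx2 ⟨⟨hxS, ?_⟩, hne⟩
      have h1 : ‖x - y‖ < 1 := by simpa [dist_eq_norm] using hx1
      have h2 : ‖x‖ ≤ ‖y‖ + ‖x - y‖ := by
        simpa using norm_add_le y (x - y)
      linarith
    · rintro _ rfl
      exact ⟨⟨by simp, by simp⟩, hy⟩
  have hlat : IsZLattice ℝ L := ⟨hspan⟩
  have : Module.Free ℤ L := ZLattice.module_free ℝ L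
  have : Module.Finite ℤ L := ZLattice.module_finite ℝ L
  let b := (Module.Free.chooseBasis ℤ L).reindex (Fintype.equivFin _)
  refine ⟨_, b.ofZLatticeBasis ℝ L, ?_⟩
  have h := congrArg Submodule.toAddSubgroup (b.ofZLatticeBasis_span ℝ L)
  rw [Submodule.span_int_eq_addSubgroupClosure] at h
  exact h.symm

theorem IsLatticeIn.finite_norm_le [FiniteDimensional ℝ W] {S : AddSubgroup W}
    (h : IsLatticeIn S) (R : ℝ) : {x : W | x ∈ S ∧ ‖x‖ ≤ R}.Finite := by
  obtain ⟨d, b, rfl⟩ := h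
  have : ProperSpace W := FiniteDimensional.proper_real W
  refine (ZSpan.setFinite_inter b (Metric.isBounded_closedBall (x := 0) (r := R))).subset ?_
  rintro x ⟨hx, hxR⟩
  refine ⟨by simpa using hxR, ?_⟩
  have : x ∈ (Submodule.span ℤ (Set.range b)).toAddSubgroup := by
    rwa [Submodule.span_int_eq_addSubgroupClosure]
  exact this

theorem IsLatticeIn.exists_norm_add_le [FiniteDimensional ℝ W] {S : AddSubgroup W}
    (h : IsLatticeIn S) : ∃ R : ℝ, ∀ x : W, ∃ s ∈ S, ‖x + s‖ ≤ R := by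
  obtain ⟨d, b, rfl⟩ := h
  refine ⟨∑ i, ‖b i‖, fun x => ⟨-(ZSpan.floor b x : W), ?_, ?_⟩⟩
  · refine neg_mem ?_
    rw [← Submodule.span_int_eq_addSubgroupClosure]
    exact (ZSpan.floor b x).2
  · rw [← sub_eq_add_neg]
    exact ZSpan.norm_fract_le b x

theorem Submodule.eq_top_of_exists_norm_add_le [FiniteDimensional ℝ W] (S : Submodule ℝ W) {R : ℝ}
    (h : ∀ x : W, ∃ s ∈ S, ‖x + s‖ ≤ R) : S = ⊤ := by
  by_contra hne
  obtain ⟨f, hf, hS⟩ := Submodule.exists_le_ker_of_lt_top S (lt_top_iff_ne_top.2 hne)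
  obtain ⟨v, hv⟩ : ∃ v, f v ≠ 0 := by
    by_contra! hall
    exact hf (LinearMap.ext hall)
  let F := LinearMap.toContinuousLinearMap f
  -- On this vector, and on all its translates by `S`, the functional equals `‖F‖ * R + 1`, too
  -- large for a vector of norm at most `R`.
  obtain ⟨s, hs, hR⟩ := h (((‖F‖ * R + 1) / f v) • v)
  have h1 : F (((‖F‖ * R + 1) / f v) • v + s) = ‖F‖ * R + 1 := by
    have : f s = 0 := hS hs
    change f _ = _
    rw [map_add, map_smul, this, smul_eq_mul, div_mul_cancel₀ _ hv, add_zero]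
  have h2 := F.le_opNorm (((‖F‖ * R + 1) / f v) • v + s)
  rw [h1] at h2
  have h3 : ‖F‖ * ‖((‖F‖ * R + 1) / f v) • v + s‖ ≤ ‖F‖ * R := by gcongr
  have h4 := le_abs_self (‖F‖ * R + 1)
  rw [← Real.norm_eq_abs] at h4
  linarith

/-- A linear map that sends an additive subgroup properly onto a spanning subset is injective on
the linear span of the subgroup. -/
theorem eq_zero_of_mem_span_of_finite [FiniteDimensional ℝ W] [AddCommGroup W'] [Module ℝ W']
    (φ : W' →ₗ[ℝ] W) (S : AddSubgroup W') (hfin : ∀ R : ℝ, {x | x ∈ S ∧ ‖φ x‖ ≤ R}.Finite)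
    (hspan : Submodule.span ℝ (φ '' S) = ⊤) {x : W'} (hx : x ∈ Submodule.span ℝ (S : Set W'))
    (h0 : φ x = 0) : x = 0 := by
  -- A nonzero element of `S` in the kernel would have infinitely many multiples there, against
  -- finiteness for `R = 0`.
  have hinj : ∀ x ∈ S, φ x = 0 → x = 0 := by
    intro x hx hx0
    by_contra hne
    refine Set.infinite_univ (α := ℕ) (Set.Finite.of_finite_image (f := fun n : ℕ => n • x)
      ((hfin 0).subset ?_) ?_)
    · rintro _ ⟨n, -, rfl⟩
      exact ⟨nsmul_mem hx n, by simp [hx0]⟩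
    · intro m _ n _ hmn
      have hmn : m • x = n • x := hmn
      rw [← Nat.cast_smul_eq_nsmul ℝ, ← Nat.cast_smul_eq_nsmul ℝ] at hmn
      exact_mod_cast smul_left_injective ℝ hne hmn
  -- The image of `S` is a lattice. Lifting its basis to `S` gives a linear section `g` of `φ`;
  -- injectivity on `S` makes `g ∘ φ` the identity on `S`, hence on its span.
  obtain ⟨d, b, hb⟩ : IsLatticeIn (S.map φ.toAddMonoidHom) := by
    refine isLatticeIn_of_finite (fun R => ?_) (by simpa using hspan)
    refine ((hfin R).image φ).subset ?_
    rintro _ ⟨⟨y, hy, rfl⟩, hyR⟩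
    exact ⟨y, ⟨hy, hyR⟩, rfl⟩
  have hbm : ∀ i, ∃ y ∈ S, φ y = b i := fun i => by
    have : b i ∈ S.map φ.toAddMonoidHom := hb ▸ AddSubgroup.subset_closure ⟨i, rfl⟩
    exact this
  choose y hyS hyb using hbm
  let g : W →ₗ[ℝ] W' := b.constr ℝ y
  have hg : ∀ i, g (b i) = y i := fun i => b.constr_basis ℝ y i
  have hgS : ∀ z ∈ S.map φ.toAddMonoidHom, g z ∈ S := by
    intro z hz
    rw [hb] at hz
    induction hz using AddSubgroup.closure_induction with
    | mem z hz => obtain ⟨i, rfl⟩ := hz; rw [hg]; exact hyS i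
    | zero => rw [map_zero]; exact zero_mem _
    | add z z' _ _ hz hz' => rw [map_add]; exact add_mem hz hz'
    | neg z _ hz => rw [map_neg]; exact neg_mem hz
  have hφg : φ ∘ₗ g = LinearMap.id := b.ext fun i => by simp [hg, hyb]
  have hgφ : ∀ z ∈ Submodule.span ℝ (S : Set W'), g (φ z) = z := by
    intro z hz
    induction hz using Submodule.span_induction with
    | mem z hz =>
      refine sub_eq_zero.1 (hinj _ (sub_mem (hgS _ ⟨z, hz, rfl⟩) hz) ?_)
      rw [map_sub]
      exact sub_eq_zero.2 (LinearMap.congr_fun hφg (φ z))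
    | zero => simp
    | add z z' _ _ hz hz' => rw [map_add, map_add, hz, hz']
    | smul c z _ hz => rw [map_smul, map_smul, hz]
  rw [← hgφ x hx, h0, map_zero]

end Lattice

/-! ### Function spaces that evaluate isomorphically onto `V` -/

section Frame

variable {V : Type u} [NormedAddCommGroup V] [NormedSpace ℝ V]

/-- `E` is the evolution operator, with inverse `F`, of a space `L` of smooth functions that is
mapped isomorphically onto `V` by all evaluations. -/
structure IsFrame (L : Submodule ℝ (ℝ → V)) (E F : ℝ → V →L[ℝ] V) : Prop where
  smooth : ContDiff ℝ ∞ E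
  smooth_inv : ContDiff ℝ ∞ F
  mul_inv : ∀ t v, E t (F t v) = v
  inv_mul : ∀ t v, F t (E t v) = v
  mem : ∀ v, (fun t => E t v) ∈ L
  eq : ∀ u ∈ L, ∀ t, u t = E t (u 0)

theorem exists_isFrame [FiniteDimensional ℝ V] (L : Submodule ℝ (ℝ → V))
    (hsm : ∀ u ∈ L, ContDiff ℝ ∞ u) (hinj : ∀ u ∈ L, ∀ t, u t = 0 → u = 0)
    (hsurj : ∀ t v, ∃ u ∈ L, u t = v) : ∃ E F, IsFrame L E F := by
  have : CompleteSpace V := FiniteDimensional.complete ℝ V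
  let ev : ∀ t : ℝ, L ≃ₗ[ℝ] V := fun t =>
    LinearEquiv.ofBijective ((LinearMap.proj t).comp L.subtype) ⟨by
      rw [injective_iff_map_eq_zero]
      exact fun u hu => Subtype.ext (hinj u u.2 t hu), fun v => by
      obtain ⟨u, hu, hv⟩ := hsurj t v
      exact ⟨⟨u, hu⟩, hv⟩⟩
  let E : ℝ → V ≃L[ℝ] V := fun t => ((ev 0).symm.trans (ev t)).toContinuousLinearEquiv
  have hE : ∀ t v, E t v = ((ev 0).symm v : ℝ → V) t := fun t v => rfl
  have hsmooth : ContDiff ℝ ∞ fun t => (E t : V →L[ℝ] V) := by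
    rw [contDiff_clm_apply_iff]
    exact fun v => hsm _ ((ev 0).symm v).2
  refine ⟨fun t => E t, fun t => (E t).symm, hsmooth, ?_, fun t v => (E t).apply_symm_apply v,
    fun t v => (E t).symm_apply_apply v, fun v => ((ev 0).symm v).2, fun u hu t => ?_⟩
  · rw [contDiff_iff_contDiffAt]
    intro t
    have h := contDiffAt_map_inverse (𝕜 := ℝ) (n := ∞) (E t)
    have h2 := h.comp t hsmooth.contDiffAt
    refine h2.congr_of_eventuallyEq (Filter.Eventually.of_forall fun s => ?_)
    exact (ContinuousLinearMap.inverse_equiv (E s)).symm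
  · change u t = E t (u 0)
    rw [hE]
    have : (ev 0).symm (u 0) = ⟨u, hu⟩ := by
      rw [LinearEquiv.symm_apply_eq]
      rfl
    rw [this]

namespace IsFrame

variable {L : Submodule ℝ (ℝ → V)} {E F : ℝ → V →L[ℝ] V}

theorem apply_zero (h : IsFrame L E F) (v : V) : E 0 v = v := by
  have h1 := h.eq _ (h.mem v) 0
  have h2 := congrArg (F 0) h1
  simp only [h.inv_mul] at h2
  exact h2.symm

theorem inv_apply (h : IsFrame L E F) {u : ℝ → V} (hu : u ∈ L) (t : ℝ) : F t (u t) = u 0 := by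
  rw [h.eq u hu t, h.inv_mul]

/-- The evaluation at zero as an isomorphism. -/
noncomputable def evalZero (h : IsFrame L E F) : L ≃ₗ[ℝ] V where
  toFun u := (u : ℝ → V) 0
  map_add' _ _ := rfl
  map_smul' _ _ := rfl
  invFun v := ⟨_, h.mem v⟩
  left_inv u := by
    ext t
    exact (h.eq u u.2 t).symm
  right_inv v := h.apply_zero v

theorem evalZero_apply (h : IsFrame L E F) (u : L) : h.evalZero u = (u : ℝ → V) 0 := rfl

theorem hasDerivAt (h : IsFrame L E F) {u : ℝ → V} (hu : u ∈ L) (t : ℝ) :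
    HasDerivAt u ((deriv E t * F t) (u t)) t := by
  have h1 : u = fun t => E t (u 0) := funext (h.eq u hu)
  have h2 := ((h.smooth.differentiable (by simp) t).hasDerivAt).clm_apply
    (hasDerivAt_const t (u 0))
  rw [map_zero, add_zero] at h2
  rw [mul_apply_eq_comp, h.inv_apply hu]
  rwa [← h1] at h2

theorem contDiff_coefficient (h : IsFrame L E F) : ContDiff ℝ ∞ fun t => deriv E t * F t :=
  (contDiff_infty_iff_deriv.1 h.smooth).2.clm_comp h.smooth_inv

/-- Reconstructs `B` from its solution space: `B = Ė E⁻¹`. A solution `w` and the element of `L`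
with the same value at `0` coincide by uniqueness. -/
theorem firstOrderSolutions_eq (h : IsFrame L E F) :
    ECSData.firstOrderSolutions (fun t => deriv E t * F t) = L := by
  refine le_antisymm (fun w hw => ?_) fun u hu => h.hasDerivAt hu
  have h2 : (fun t => E t (w 0)) ∈ ECSData.firstOrderSolutions (fun t => deriv E t * F t) :=
    h.hasDerivAt (h.mem (w 0))
  have h3 := sub_mem hw h2
  have h4 : w = fun t => E t (w 0) := by
    funext t
    refine sub_eq_zero.1 (linearODE_eq_zero h.contDiff_coefficient.continuous h3 (t₀ := 0) ?_ t)
    simp [h.apply_zero]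
  rw [h4]
  exact h.mem _

end IsFrame

/-- Existence of solutions with prescribed value at `0` fixes the dimension; at other `t`,
injectivity then forces surjectivity. -/
theorem exists_isFrame_firstOrderSolutions [FiniteDimensional ℝ V] {B : ℝ → V →L[ℝ] V}
    (hB : ContDiff ℝ ∞ B) : ∃ E F, IsFrame (ECSData.firstOrderSolutions B) E F := by
  have : CompleteSpace V := FiniteDimensional.complete ℝ V
  have hinj : ∀ u ∈ ECSData.firstOrderSolutions B, ∀ t, u t = 0 → u = 0 :=
    fun u hu t ht => funext fun s => linearODE_eq_zero hB.continuous hu ht s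
  let ev : ∀ t : ℝ, ECSData.firstOrderSolutions B →ₗ[ℝ] V := fun t =>
    (LinearMap.proj t).comp (ECSData.firstOrderSolutions B).subtype
  have hev : ∀ t, Function.Injective (ev t) := fun t => by
    rw [injective_iff_map_eq_zero]
    exact fun u hu => Subtype.ext (hinj u u.2 t hu)
  have hev0 : Function.Surjective (ev 0) := fun v => by
    obtain ⟨y, hy0, hy⟩ := exists_linearODE_solution hB.continuous v
    exact ⟨⟨y, hy⟩, hy0⟩
  let e := LinearEquiv.ofBijective (ev 0) ⟨hev 0, hev0⟩
  have : FiniteDimensional ℝ (ECSData.firstOrderSolutions B) := e.symm.finiteDimensional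
  refine exists_isFrame _ (fun u hu => contDiff_of_linearODE hB hu) hinj fun t v => ?_
  obtain ⟨u, hu⟩ := (LinearMap.injective_iff_surjective_of_finrank_eq_finrank e.finrank_eq).1
    (hev t) v
  exact ⟨u, u.2, hu⟩

end Frame

/-! ### The solution space `𝓔` and the kernel of `Π` in `Γ` -/

namespace ECSData

variable {V : Type u} [NormedAddCommGroup V] [NormedSpace ℝ V]

/-- The operator `(x, y) ↦ (y, f x + A x)` of the first-order system on `V × V` equivalent to
`ü = f u + A u`. -/
noncomputable def systemOperator (D : ECSData V) (t : ℝ) : V × V →L[ℝ] V × V :=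
  (ContinuousLinearMap.snd ℝ V V).prod
    ((D.f t • (1 : V →L[ℝ] V) + D.A).comp (ContinuousLinearMap.fst ℝ V V))

theorem systemOperator_apply (D : ECSData V) (t : ℝ) (x : V × V) :
    D.systemOperator t x = (x.2, D.f t • x.1 + D.A x.1) := by
  simp [systemOperator]

theorem contDiff_systemOperator (D : ECSData V) : ContDiff ℝ ∞ D.systemOperator := by
  have := D.finiteDimensional
  rw [contDiff_clm_apply_iff]
  intro x
  simp only [systemOperator_apply]
  exact contDiff_const.prodMk ((D.f_smooth.smul contDiff_const).add contDiff_const)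

theorem solutions_eq_zero (D : ECSData V) (u : D.solutions) {t : ℝ} (h0 : (u : ℝ → V) t = 0)
    (h1 : deriv (u : ℝ → V) t = 0) : u = 0 := by
  have h := linearODE_eq_zero D.contDiff_systemOperator.continuous
    (y := fun t => ((u : ℝ → V) t, deriv (u : ℝ → V) t)) (fun s => by
      rw [systemOperator_apply]
      exact (D.solutions_hasDerivAt u s).prodMk (D.solutions_hasDerivAt_deriv u s)) (t₀ := t)
    (by simp [h0, h1])
  ext s
  exact congrArg Prod.fst (h s)

theorem exists_solution (D : ECSData V) (a b : V) :
    ∃ u : D.solutions, (u : ℝ → V) 0 = a ∧ deriv (u : ℝ → V) 0 = b := by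
  have := D.finiteDimensional
  have : CompleteSpace V := FiniteDimensional.complete ℝ V
  obtain ⟨y, hy0, hy⟩ := exists_linearODE_solution D.contDiff_systemOperator.continuous (a, b)
  have hsm := contDiff_of_linearODE D.contDiff_systemOperator hy
  have h1 : ∀ t, HasDerivAt (fun t => (y t).1) (y t).2 t := fun t => by
    have := hy t
    rw [systemOperator_apply] at this
    exact this.fst
  have h2 : ∀ t, HasDerivAt (fun t => (y t).2) (D.f t • (y t).1 + D.A (y t).1) t := fun t => by
    have := hy t
    rw [systemOperator_apply] at this
    exact this.snd
  have hd : deriv (fun t => (y t).1) = fun t => (y t).2 := funext fun t => (h1 t).deriv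
  refine ⟨⟨fun t => (y t).1, hsm.fst, fun t => ?_⟩, ?_, ?_⟩
  · rw [hd]
    exact (h2 t).deriv
  · simp [hy0]
  · change deriv (fun t => (y t).1) 0 = b
    rw [hd]
    exact congrArg Prod.snd hy0

theorem deriv_smul_apply (D : ECSData V) (c : ℝ) (u : D.solutions) (t : ℝ) :
    deriv (c • (u : ℝ → V)) t = c • deriv (u : ℝ → V) t :=
  deriv_const_smul c (D.solutions_differentiable u t)

theorem Omega_smul_right (D : ECSData V) (c : ℝ) (u w : D.solutions) :
    D.Omega u (c • w) = c * D.Omega u w := by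
  simp only [D.Omega_eq _ _ 0, deriv_smul_apply, Submodule.coe_smul, Pi.smul_apply, map_smul,
    smul_eq_mul]
  ring

theorem Omega_swap (D : ECSData V) (u w : D.solutions) : D.Omega u w = -D.Omega w u := by
  simp only [D.Omega_eq _ _ 0, D.ip_symm.eq (deriv (u : ℝ → V) 0),
    D.ip_symm.eq ((u : ℝ → V) 0)]
  ring

/-- The form `Ω(u, ·)` as a linear functional. -/
noncomputable def OmegaRight (D : ECSData V) (u : D.solutions) : D.solutions →ₗ[ℝ] ℝ where
  toFun := D.Omega u
  map_add' := D.Omega_add_right u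
  map_smul' c w := D.Omega_smul_right c u w

theorem exists_abs_ip_le (D : ECSData V) : ∃ c : ℝ, 0 ≤ c ∧ ∀ v w, |D.ip v w| ≤ c * ‖v‖ * ‖w‖ := by
  have := D.finiteDimensional
  let b : V →L[ℝ] V →L[ℝ] ℝ := D.ip.toContinuousBilinearMap
  refine ⟨‖b‖, b.opNorm_nonneg, fun v w => ?_⟩
  have h := b.le_opNorm₂ v w
  rwa [LinearMap.toContinuousBilinearMap_apply, Real.norm_eq_abs] at h

theorem contDiff_ip (D : ECSData V) {E : Type*} [NormedAddCommGroup E] [NormedSpace ℝ E]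
    {x y : E → V} (hx : ContDiff ℝ ∞ x) (hy : ContDiff ℝ ∞ y) :
    ContDiff ℝ ∞ fun e => D.ip (x e) (y e) := by
  have := D.finiteDimensional
  let b : V →L[ℝ] V →L[ℝ] ℝ := D.ip.toContinuousBilinearMap
  exact (b.contDiff.comp hx).clm_apply hy

theorem smul_def (D : ECSData V) (g : D.G) (x : D.MHat) :
    g • x = ((x.1 + g.k * D.p,
      x.2.1 + g.q - D.ip (deriv (g.u : ℝ → V) x.1) ((2 : ℝ) • x.2.2 + (g.u : ℝ → V) x.1),
      x.2.2 + (g.u : ℝ → V) x.1) : D.MHat) := rfl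

theorem contDiff_smul (D : ECSData V) (g : D.G) : ContDiff ℝ ∞ fun x : D.MHat => g • x := by
  have hu : ContDiff ℝ ∞ fun x : D.MHat => (g.u : ℝ → V) x.1 := g.u.2.1.comp contDiff_fst
  have hdu : ContDiff ℝ ∞ fun x : D.MHat => deriv (g.u : ℝ → V) x.1 :=
    (contDiff_infty_iff_deriv.1 g.u.2.1).2.comp contDiff_fst
  have hv : ContDiff ℝ ∞ fun x : D.MHat => x.2.2 := contDiff_snd.comp contDiff_snd
  have hs : ContDiff ℝ ∞ fun x : D.MHat => x.2.1 := contDiff_fst.comp contDiff_snd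
  exact (contDiff_fst.add contDiff_const).prodMk
    (((hs.add contDiff_const).sub (D.contDiff_ip hdu ((hv.const_smul (2 : ℝ)).add hu))).prodMk
      (hv.add hu))

theorem zpow_k (D : ECSData V) (g : D.G) (k : ℤ) : (g ^ k).k = k * g.k := by
  have h := map_zpow D.Pi g k
  exact (congrArg Multiplicative.toAdd h).trans (by rw [toAdd_zpow, smul_eq_mul]; rfl)

theorem mul_k (D : ECSData V) (g h : D.G) : (g * h).k = g.k + h.k := rfl

theorem mul_kernel (D : ECSData V) (q r : ℝ) (u w : D.solutions) :
    (⟨0, q, u⟩ * ⟨0, r, w⟩ : D.G) = ⟨0, q + r - D.Omega u w, u + w⟩ := by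
  simp [mul_def]

theorem inv_kernel (D : ECSData V) (q : ℝ) (u : D.solutions) :
    (⟨0, q, u⟩⁻¹ : D.G) = ⟨0, -q, -u⟩ := by
  simp [inv_def]

/-- The origin of `Ψ`: the functional `φ` is `-2 Ω(u, ·)`. -/
theorem conj_kernel (D : ECSData V) (q r : ℝ) (u w : D.solutions) :
    (⟨1, q, u⟩ * ⟨0, r, w⟩ * ⟨1, q, u⟩⁻¹ : D.G) = ⟨0, r - 2 * D.Omega u w, D.T w⟩ := by
  rw [mul_inv_eq_iff_eq_mul]
  simp only [mul_def, G.mk.injEq]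
  have h := D.Omega_T_zpow 1 w u
  rw [zpow_one] at h
  refine ⟨by simp, ?_, ?_⟩
  · rw [zpow_zero, zpow_one, h, D.Omega_swap w u]
    simp only [LinearEquiv.coe_one, id]
    ring
  · rw [neg_zero, zpow_zero, zpow_neg_one]
    have : D.T⁻¹ (D.T w) = w := D.T.symm_apply_apply w
    rw [this]
    exact add_comm u w

theorem deriv_eq_of_mem_firstOrderSolutions {B : ℝ → V →L[ℝ] V} {u : ℝ → V}
    (hu : u ∈ firstOrderSolutions B) (t : ℝ) : deriv u t = B t (u t) := (hu t).deriv

theorem firstOrderSolutions_le (D : ECSData V) {B : ℝ → V →L[ℝ] V} (hB : ContDiff ℝ ∞ B)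
    (h : ∀ t, deriv B t + B t * B t = D.f t • (1 : V →L[ℝ] V) + D.A) :
    firstOrderSolutions B ≤ D.solutions := by
  intro u hu
  refine ⟨contDiff_of_linearODE hB hu, fun t => ?_⟩
  rw [funext (deriv_eq_of_mem_firstOrderSolutions hu)]
  have h1 := ((hB.differentiable (by simp) t).hasDerivAt.clm_apply (hu t)).deriv
  rw [h1]
  simpa using congrArg (fun L : V →L[ℝ] V => L (u t)) (h t)

/-- Properness on the slice of `t`, read off from the orbit of `(t, 0, 0)`, which `(0, q, u)` moves
to `(t, q - ⟨u̇(t), u(t)⟩, u(t))`. -/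
theorem finite_kernel_orbit (D : ECSData V) {Γ : Subgroup D.G} (hfree : ActsFreely Γ D.MHat)
    (hq : IsProperlyDiscontinuousCocompact Γ D.MHat) (t R : ℝ) :
    {x : ℝ × D.solutions | (⟨0, x.1, x.2⟩ : D.G) ∈ Γ ∧
      |x.1 - D.ip (deriv (x.2 : ℝ → V) t) ((x.2 : ℝ → V) t)| ≤ R ∧
      ‖(x.2 : ℝ → V) t‖ ≤ R}.Finite := by
  have := D.finiteDimensional
  have : ProperSpace D.MHat := FiniteDimensional.proper_real _
  obtain ⟨M, _, _, π, hM, _⟩ := hq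
  have hfin := hM.finite_of_smul_mem hfree ((t, 0, 0) : D.MHat)
    (isCompact_closedBall (0 : D.MHat) (max |t| R))
  refine Set.Finite.subset (hfin.image fun g : Γ => (g.1.q, g.1.u)) ?_
  rintro ⟨q, u⟩ ⟨hg, h1, h2⟩
  refine ⟨⟨_, hg⟩, ?_, rfl⟩
  change (⟨0, q, u⟩ : D.G) • ((t, 0, 0) : D.MHat) ∈ Metric.closedBall (0 : D.MHat) (max |t| R)
  rw [mem_closedBall_zero_iff, smul_def, norm_prod_le_iff, norm_prod_le_iff]
  refine ⟨by simp, ?_, ?_⟩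
  · simpa using Or.inr h1
  · simpa using Or.inr h2

theorem exists_kernel_translate (D : ECSData V) {Γ : Subgroup D.G}
    (hq : IsProperlyDiscontinuousCocompact Γ D.MHat) {γ : D.G} (hγ : γ ∈ Γ) (hγk : γ.k = 1)
    (t : ℝ) : ∃ R : ℝ, ∀ (s : ℝ) (v : V), ∃ (q : ℝ) (u : D.solutions), (⟨0, q, u⟩ : D.G) ∈ Γ ∧
      |s + q - D.ip (deriv (u : ℝ → V) t) ((2 : ℝ) • v + (u : ℝ → V) t)| ≤ R ∧
      ‖v + (u : ℝ → V) t‖ ≤ R := by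
  have := D.finiteDimensional
  have : ProperSpace D.MHat := FiniteDimensional.proper_real _
  obtain ⟨M, _, _, π, hM, hMc⟩ := hq
  obtain ⟨R₀, hR₀⟩ := hM.exists_compact_cover
  -- An element moving the slice of `t` into the ball of radius `R₀` has `|k| ≤ N`. Only finitely
  -- many powers of `γ` are then needed to return to the slice, and they move the ball within a
  -- compact set.
  obtain ⟨N, hN⟩ := exists_nat_gt ((|t| + R₀) / D.p)
  have hp := D.p_pos
  have hK : IsCompact (⋃ k ∈ Set.Icc (-(N : ℤ)) N,
      (fun x : D.MHat => γ ^ (-k) • x) '' Metric.closedBall 0 R₀) :=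
    (Set.finite_Icc _ _).isCompact_biUnion fun k _ =>
      (isCompact_closedBall _ _).image (D.contDiff_smul _).continuous
  obtain ⟨R, hR⟩ := hK.isBounded.exists_norm_le
  refine ⟨R, fun s v => ?_⟩
  obtain ⟨g, hg⟩ := hR₀ (t, s, v)
  have hgt : |t + g.1.k * D.p| ≤ R₀ := by
    have : (g • ((t, s, v) : D.MHat)).1 = t + g.1.k * D.p := rfl
    rw [← this]
    exact (norm_fst_le _).trans hg
  have hk : |(g.1.k : ℝ)| ≤ N := by
    have h1 : |(g.1.k : ℝ) * D.p| ≤ |t| + R₀ := by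
      rw [abs_le] at hgt ⊢
      constructor <;> linarith [neg_abs_le t, le_abs_self t]
    rw [abs_mul, abs_of_pos hp, ← le_div_iff₀ hp] at h1
    exact h1.trans hN.le
  have hk' : g.1.k ∈ Set.Icc (-(N : ℤ)) N := by
    rw [abs_le] at hk
    exact ⟨by exact_mod_cast hk.1, by exact_mod_cast hk.2⟩
  set h : D.G := γ ^ (-g.1.k) * g.1 with hh
  have hhΓ : h ∈ Γ := mul_mem (zpow_mem hγ _) g.2
  have hh0 : h.k = 0 := by rw [hh, mul_k, zpow_k, hγk]; ring
  have hhe : (⟨0, h.q, h.u⟩ : D.G) = h := by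
    ext <;> simp [hh0]
  have hx := hR (h • ((t, s, v) : D.MHat)) (by
    refine Set.mem_biUnion hk' ⟨g.1 • ((t, s, v) : D.MHat), mem_closedBall_zero_iff.2 hg, ?_⟩
    rw [hh, mul_smul])
  refine ⟨h.q, h.u, hhe ▸ hhΓ, ?_, ?_⟩
  · exact ((norm_fst_le _).trans (norm_snd_le _)).trans hx
  · exact ((norm_snd_le _).trans (norm_snd_le _)).trans hx

/-- The image in `𝓔` of the elements of `Γ` that preserve the coordinate `t`. -/
noncomputable def kernelImage (D : ECSData V) (Γ : Subgroup D.G) : AddSubgroup D.solutions where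
  carrier := {u | ∃ q, (⟨0, q, u⟩ : D.G) ∈ Γ}
  zero_mem' := ⟨0, one_mem Γ⟩
  add_mem' := by
    rintro u w ⟨q, hu⟩ ⟨r, hw⟩
    exact ⟨_, D.mul_kernel q r u w ▸ mul_mem hu hw⟩
  neg_mem' := by
    rintro u ⟨q, hu⟩
    exact ⟨_, D.inv_kernel q u ▸ inv_mem hu⟩

/-- The intersection of `Γ` with the center `ℝ` of the Heisenberg group `ℝ × 𝓔`. -/
noncomputable def kernelCenter (D : ECSData V) (Γ : Subgroup D.G) : AddSubgroup ℝ where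
  carrier := {q | (⟨0, q, 0⟩ : D.G) ∈ Γ}
  zero_mem' := one_mem Γ
  add_mem' := by
    intro q r hq hr
    have h : (⟨0, q, 0⟩ * ⟨0, r, 0⟩ : D.G) ∈ Γ := mul_mem hq hr
    rwa [mul_kernel, Omega_zero_left, sub_zero, add_zero] at h
  neg_mem' := by
    intro q hq
    have h : (⟨0, q, 0⟩⁻¹ : D.G) ∈ Γ := inv_mem hq
    rwa [inv_kernel, neg_zero] at h

theorem mem_kernelCenter (D : ECSData V) {Γ : Subgroup D.G} {q : ℝ} :
    q ∈ D.kernelCenter Γ ↔ (⟨0, q, 0⟩ : D.G) ∈ Γ := Iff.rfl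

theorem kernel_add_mem (D : ECSData V) {Γ : Subgroup D.G} {q r : ℝ} {u : D.solutions}
    (hu : (⟨0, q, u⟩ : D.G) ∈ Γ) (hr : r ∈ D.kernelCenter Γ) :
    (⟨0, q + r, u⟩ : D.G) ∈ Γ := by
  have h := mul_mem hu hr
  rwa [mul_kernel, Omega_zero_right, sub_zero, add_zero] at h

/-- `2 Ω(u, w)` is the central component of `(g h)⁻¹ (h g)`, for `g`, `h` over `u`, `w`. -/
theorem two_mul_Omega_mem (D : ECSData V) {Γ : Subgroup D.G} {u w : D.solutions}
    (hu : u ∈ D.kernelImage Γ) (hw : w ∈ D.kernelImage Γ) :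
    2 * D.Omega u w ∈ D.kernelCenter Γ := by
  obtain ⟨q, hu⟩ := hu
  obtain ⟨r, hw⟩ := hw
  have h := mul_mem (inv_mem (mul_mem hu hw)) (mul_mem hw hu)
  rw [mul_kernel, mul_kernel, inv_kernel, mul_kernel, D.Omega_swap w u, Omega_neg_left,
    add_comm w u, Omega_self] at h
  rw [mem_kernelCenter]
  convert h using 2
  · ring
  · abel

/-- A subgroup of `ℝ` with finitely many elements in `[-1, 1]` is not dense, hence cyclic. The
generator is written `2θ` so that `Ω` takes its values in `ℤθ`. -/
theorem exists_kernelCenter_eq (D : ECSData V) {Γ : Subgroup D.G}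
    (hP : ∀ t R : ℝ, {x : ℝ × D.solutions | (⟨0, x.1, x.2⟩ : D.G) ∈ Γ ∧
      |x.1 - D.ip (deriv (x.2 : ℝ → V) t) ((x.2 : ℝ → V) t)| ≤ R ∧
      ‖(x.2 : ℝ → V) t‖ ≤ R}.Finite) :
    ∃ θ : ℝ, 0 ≤ θ ∧ ∀ q, q ∈ D.kernelCenter Γ ↔ ∃ m : ℤ, q = m * (2 * θ) := by
  have hfin : {q : ℝ | q ∈ D.kernelCenter Γ ∧ |q| ≤ 1}.Finite := by
    refine Set.Finite.of_finite_image (f := fun q : ℝ => (q, (0 : D.solutions)))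
      ((hP 0 1).subset ?_) fun a _ b _ hab => (Prod.ext_iff.1 hab).1
    rintro _ ⟨q, ⟨hq, hq1⟩, rfl⟩
    refine ⟨hq, ?_, ?_⟩ <;> simp [hq1]
  rcases AddSubgroup.dense_or_cyclic (D.kernelCenter Γ) with hd | ⟨a, ha⟩
  · exfalso
    have h1 : (Set.Icc (-1 : ℝ) 1) ⊆ {q : ℝ | q ∈ D.kernelCenter Γ ∧ |q| ≤ 1} := by
      have h2 : Set.Ioo (-1 : ℝ) 1 ⊆ closure {q : ℝ | q ∈ D.kernelCenter Γ ∧ |q| ≤ 1} := by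
        refine (hd.open_subset_closure_inter isOpen_Ioo).trans (closure_mono ?_)
        rintro q ⟨hq, hqS⟩
        exact ⟨hqS, abs_le.2 ⟨hq.1.le, hq.2.le⟩⟩
      rw [hfin.isClosed.closure_eq] at h2
      rw [← closure_Ioo (by norm_num : (-1 : ℝ) ≠ 1)]
      exact closure_minimal h2 hfin.isClosed
    exact (Set.Icc_infinite (by norm_num : (-1 : ℝ) < 1)) (hfin.subset h1)
  · refine ⟨|a| / 2, by positivity, fun q => ?_⟩
    rw [ha, AddSubgroup.mem_closure_singleton]
    have h2 : 2 * (|a| / 2) = |a| := by ring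
    rw [h2]
    constructor
    · rintro ⟨m, rfl⟩
      rcases abs_choice a with h | h
      · exact ⟨m, by rw [h]; simp⟩
      · exact ⟨-m, by rw [h]; simp⟩
    · rintro ⟨m, rfl⟩
      rcases abs_choice a with h | h
      · exact ⟨m, by rw [h]; simp⟩
      · exact ⟨-m, by rw [h]; simp⟩

/-- The evaluation `u ↦ u(t)` on `𝓔`. -/
def evalAt (D : ECSData V) (t : ℝ) : D.solutions →ₗ[ℝ] V :=
  (LinearMap.proj t).comp D.solutions.subtype

theorem span_evalAt_kernelImage (D : ECSData V) {Γ : Subgroup D.G} {t : ℝ}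
    (hC : ∃ R : ℝ, ∀ (s : ℝ) (v : V), ∃ (q : ℝ) (u : D.solutions), (⟨0, q, u⟩ : D.G) ∈ Γ ∧
      |s + q - D.ip (deriv (u : ℝ → V) t) ((2 : ℝ) • v + (u : ℝ → V) t)| ≤ R ∧
      ‖v + (u : ℝ → V) t‖ ≤ R) :
    Submodule.span ℝ (D.evalAt t '' D.kernelImage Γ) = ⊤ := by
  have := D.finiteDimensional
  obtain ⟨R, hR⟩ := hC
  refine Submodule.eq_top_of_exists_norm_add_le _ (R := R) fun v => ?_
  obtain ⟨q, u, hu, -, h⟩ := hR 0 v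
  exact ⟨_, Submodule.subset_span ⟨u, ⟨q, hu⟩, rfl⟩, h⟩

theorem Omega_eq_zero_of_mem_span (D : ECSData V) {S : Set D.solutions} {u w : D.solutions}
    (hS : ∀ u ∈ S, ∀ w ∈ S, D.Omega u w = 0) (hu : u ∈ Submodule.span ℝ S)
    (hw : w ∈ Submodule.span ℝ S) : D.Omega u w = 0 := by
  have h1 : ∀ u ∈ S, ∀ w ∈ Submodule.span ℝ S, D.Omega u w = 0 := fun u hu w hw => by
    have : Submodule.span ℝ S ≤ LinearMap.ker (D.OmegaRight u) :=
      Submodule.span_le.2 fun w hw => hS u hu w hw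
    exact this hw
  have h2 : Submodule.span ℝ S ≤ LinearMap.ker (D.OmegaRight w) :=
    Submodule.span_le.2 fun u hu => by
      change D.Omega w u = 0
      rw [Omega_swap, h1 u hu w hw, neg_zero]
  have h3 : D.Omega w u = 0 := h2 hu
  rw [Omega_swap, h3, neg_zero]

/-- Together with surjectivity, this makes evaluation at `t` an isomorphism of the span onto `V`.
The cases `θ = 0` and `θ > 0` need different arguments: isotropy for `Ω`, and discreteness. -/
theorem eq_zero_of_mem_span_kernelImage (D : ECSData V) {Γ : Subgroup D.G}
    (hP : ∀ t R : ℝ, {x : ℝ × D.solutions | (⟨0, x.1, x.2⟩ : D.G) ∈ Γ ∧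
      |x.1 - D.ip (deriv (x.2 : ℝ → V) t) ((x.2 : ℝ → V) t)| ≤ R ∧
      ‖(x.2 : ℝ → V) t‖ ≤ R}.Finite) {t : ℝ}
    (hspan : Submodule.span ℝ (D.evalAt t '' D.kernelImage Γ) = ⊤) {u : D.solutions}
    (hu : u ∈ Submodule.span ℝ (D.kernelImage Γ : Set D.solutions)) (h0 : (u : ℝ → V) t = 0) :
    u = 0 := by
  have := D.finiteDimensional
  obtain ⟨θ, hθ, hcen⟩ := D.exists_kernelCenter_eq hP
  rcases hθ.eq_or_lt with rfl | hθ
  · have hΩ : ∀ u ∈ D.kernelImage Γ, ∀ w ∈ D.kernelImage Γ, D.Omega u w = 0 := fun u hu w hw => by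
      obtain ⟨m, hm⟩ := (hcen _).1 (D.two_mul_Omega_mem hu hw)
      simpa using hm
    refine D.solutions_eq_zero u h0 (D.ip_nondegenerate.1 _ fun v => ?_)
    have hv : v ∈ Submodule.map (D.evalAt t)
        (Submodule.span ℝ (D.kernelImage Γ : Set D.solutions)) := by
      rw [Submodule.map_span, hspan]
      trivial
    obtain ⟨w, hw, rfl⟩ := hv
    have h := D.Omega_eq_zero_of_mem_span hΩ hu hw
    rw [D.Omega_eq _ _ t, h0, map_zero, LinearMap.zero_apply, sub_zero] at h
    exact h
  · refine eq_zero_of_mem_span_of_finite (D.evalAt t) (D.kernelImage Γ) (fun R => ?_) hspan hu h0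
    refine ((hP t (max R (2 * θ))).image Prod.snd).subset ?_
    rintro w ⟨⟨q, hw⟩, hwR⟩
    set c := D.ip (deriv (w : ℝ → V) t) ((w : ℝ → V) t)
    have h2θ : 0 < 2 * θ := by linarith
    -- A central translation by a multiple of `2θ` brings `q - c` into `[0, 2θ)`, so only `u(t)`
    -- remains to be bounded.
    have hfl : Int.fract ((q - c) / (2 * θ)) * (2 * θ) =
        q + (-⌊(q - c) / (2 * θ)⌋ : ℤ) * (2 * θ) - c := by
      rw [Int.fract, sub_mul, div_mul_cancel₀ _ h2θ.ne']
      push_cast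
      ring
    refine ⟨(q + (-⌊(q - c) / (2 * θ)⌋ : ℤ) * (2 * θ), w),
      ⟨D.kernel_add_mem hw ((hcen _).2 ⟨_, rfl⟩), ?_, hwR.trans (le_max_left _ _)⟩, rfl⟩
    change |_ - c| ≤ _
    rw [← hfl, abs_of_nonneg (mul_nonneg (Int.fract_nonneg _) h2θ.le)]
    refine le_trans ?_ (le_max_right _ _)
    have := (Int.fract_lt_one ((q - c) / (2 * θ))).le
    nlinarith

end ECSData

/-! ### From the group `Γ` to the lattice -/

theorem IsLatticeIn.of_map {W W' : Type*} [AddCommGroup W] [Module ℝ W] [AddCommGroup W']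
    [Module ℝ W'] {S : AddSubgroup W} (e : W ≃ₗ[ℝ] W')
    (h : IsLatticeIn (S.map e.toLinearMap.toAddMonoidHom)) : IsLatticeIn S := by
  have h1 := h.map e.symm
  rw [AddSubgroup.map_map] at h1
  have h2 : e.symm.toLinearMap.toAddMonoidHom.comp e.toLinearMap.toAddMonoidHom =
      AddMonoidHom.id W := by
    ext x
    exact e.symm_apply_apply x
  rwa [h2, AddSubgroup.map_id] at h1

namespace ECSData

variable {V : Type u} [NormedAddCommGroup V] [NormedSpace ℝ V]

theorem exists_Omega_eq (D : ECSData V) {Γ : Subgroup D.G} {θ : ℝ}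
    (hcen : ∀ q, q ∈ D.kernelCenter Γ ↔ ∃ m : ℤ, q = m * (2 * θ)) {u w : D.solutions}
    (hu : u ∈ D.kernelImage Γ) (hw : w ∈ D.kernelImage Γ) : ∃ m : ℤ, D.Omega u w = m * θ := by
  obtain ⟨m, hm⟩ := (hcen _).1 (D.two_mul_Omega_mem hu hw)
  exact ⟨m, by linarith⟩

/-- The additive subgroup of `ℝ × 𝓛` generated by the elements of `Γ` that preserve the
coordinate `t`, together with `θ`. -/
noncomputable def kernelLattice (D : ECSData V) (Γ : Subgroup D.G) (B : ℝ → V →L[ℝ] V) {θ : ℝ}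
    (hcen : ∀ q, q ∈ D.kernelCenter Γ ↔ ∃ m : ℤ, q = m * (2 * θ)) :
    AddSubgroup (ℝ × firstOrderSolutions B) where
  carrier := {x | ∃ (q : ℝ) (u : D.solutions) (m : ℤ), (u : ℝ → V) = x.2 ∧
    (⟨0, q, u⟩ : D.G) ∈ Γ ∧ x.1 = q + m * θ}
  zero_mem' := ⟨0, 0, 0, rfl, one_mem Γ, by simp⟩
  add_mem' := by
    rintro x y ⟨q, u, m, hu, h, hx⟩ ⟨r, w, n, hw, h', hy⟩
    -- The product in `Γ` differs from the sum by `Ω(u, w) = kθ`, which the summand `ℤθ` absorbs.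
    obtain ⟨k, hk⟩ := D.exists_Omega_eq hcen ⟨q, h⟩ ⟨r, h'⟩
    refine ⟨_, u + w, m + n + k, ?_, D.mul_kernel q r u w ▸ mul_mem h h', ?_⟩
    · simp [hu, hw]
    · rw [Prod.fst_add, hx, hy, hk]
      push_cast
      ring
  neg_mem' := by
    rintro x ⟨q, u, m, hu, h, hx⟩
    refine ⟨_, -u, -m, ?_, D.inv_kernel q u ▸ inv_mem h, ?_⟩
    · simp [hu]
    · rw [Prod.fst_neg, hx]
      push_cast
      ring

theorem mem_kernelLattice (D : ECSData V) {Γ : Subgroup D.G} {B : ℝ → V →L[ℝ] V} {θ : ℝ}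
    {hcen : ∀ q, q ∈ D.kernelCenter Γ ↔ ∃ m : ℤ, q = m * (2 * θ)}
    {x : ℝ × firstOrderSolutions B} : x ∈ D.kernelLattice Γ B hcen ↔
      ∃ (q : ℝ) (u : D.solutions) (m : ℤ), (u : ℝ → V) = x.2 ∧
        (⟨0, q, u⟩ : D.G) ∈ Γ ∧ x.1 = q + m * θ := Iff.rfl

/-- The isomorphism `ℝ × 𝓛 → ℝ × V` given by evaluation at zero. -/
noncomputable def prodEvalZero {B E F : ℝ → V →L[ℝ] V}
    (hE : IsFrame (firstOrderSolutions B) E F) :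
    (ℝ × firstOrderSolutions B) ≃ₗ[ℝ] ℝ × V :=
  (LinearEquiv.refl ℝ ℝ).prodCongr hE.evalZero

theorem isLatticeIn_kernelLattice (D : ECSData V) {Γ : Subgroup D.G} {B : ℝ → V →L[ℝ] V} {θ : ℝ}
    (hθ : 0 ≤ θ) (hcen : ∀ q, q ∈ D.kernelCenter Γ ↔ ∃ m : ℤ, q = m * (2 * θ))
    (hP : ∀ t R : ℝ, {x : ℝ × D.solutions | (⟨0, x.1, x.2⟩ : D.G) ∈ Γ ∧
      |x.1 - D.ip (deriv (x.2 : ℝ → V) t) ((x.2 : ℝ → V) t)| ≤ R ∧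
      ‖(x.2 : ℝ → V) t‖ ≤ R}.Finite)
    (hC : ∃ R : ℝ, ∀ (s : ℝ) (v : V), ∃ (q : ℝ) (u : D.solutions), (⟨0, q, u⟩ : D.G) ∈ Γ ∧
      |s + q - D.ip (deriv (u : ℝ → V) 0) ((2 : ℝ) • v + (u : ℝ → V) 0)| ≤ R ∧
      ‖v + (u : ℝ → V) 0‖ ≤ R)
    {E F : ℝ → V →L[ℝ] V} (hE : IsFrame (firstOrderSolutions B) E F)
    (hL : ∀ u ∈ D.kernelImage Γ, (u : ℝ → V) ∈ firstOrderSolutions B) :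
    IsLatticeIn (D.kernelLattice Γ B hcen) := by
  have := D.finiteDimensional
  obtain ⟨c, hc0, hc⟩ := D.exists_abs_ip_le
  have hquad : ∀ {u : ℝ → V} {R : ℝ}, u ∈ firstOrderSolutions B → ‖u 0‖ ≤ R →
      |D.ip (deriv u 0) (u 0)| ≤ c * (‖B 0‖ * R) * R := fun {u R} hu hR => by
    rw [deriv_eq_of_mem_firstOrderSolutions hu]
    have hR0 : 0 ≤ R := (norm_nonneg _).trans hR
    have h1 : ‖B 0 (u 0)‖ ≤ ‖B 0‖ * R :=
      ((B 0).le_opNorm _).trans (by gcongr)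
    exact (hc _ _).trans (by gcongr)
  let e := prodEvalZero hE
  refine IsLatticeIn.of_map e (isLatticeIn_of_finite (fun R => ?_) ?_)
  · have hF := hP 0 (max (R + θ + c * (‖B 0‖ * R) * R) R)
    refine ((hF.image fun x => (x.1, (x.2 : ℝ → V) 0)).union
      (hF.image fun x => (x.1 + θ, (x.2 : ℝ → V) 0))).subset ?_
    rintro _ ⟨⟨x, hx, rfl⟩, hxR⟩
    obtain ⟨q, u, m, hu, h, hq⟩ := D.mem_kernelLattice.1 hx
    have hex : e.toLinearMap.toAddMonoidHom x = (x.1, (u : ℝ → V) 0) := by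
      rw [hu]
      rfl
    rw [hex] at hxR ⊢
    have hxR1 : |x.1| ≤ R := (norm_fst_le _).trans hxR
    have hxR2 : ‖(u : ℝ → V) 0‖ ≤ R := (norm_snd_le _).trans hxR
    have hquad := hquad (hL u ⟨q, h⟩) hxR2
    have hmem : ∀ j : ℤ, (⟨0, q + j * (2 * θ), u⟩ : D.G) ∈ Γ := fun j =>
      D.kernel_add_mem h ((hcen _).2 ⟨j, rfl⟩)
    -- The center of the kernel part is `2θℤ`, so either `(x.1, u)` or `(x.1 - θ, u)` comes from
    -- `Γ`. This is why two copies of the finite set are needed.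
    rcases Int.even_or_odd' m with ⟨j, rfl | rfl⟩
    · refine Or.inl ⟨(x.1, u), ⟨?_, ?_, hxR2.trans (le_max_right _ _)⟩, rfl⟩
      · convert hmem j using 2
        rw [hq]
        push_cast
        ring
      · refine le_trans ?_ (le_max_left _ _)
        refine (abs_sub _ _).trans ?_
        simp only at hquad ⊢
        linarith
    · refine Or.inr ⟨(x.1 - θ, u), ⟨?_, ?_, hxR2.trans (le_max_right _ _)⟩, ?_⟩
      · convert hmem j using 2
        rw [hq]
        push_cast
        ring
      · refine le_trans ?_ (le_max_left _ _)
        refine (abs_sub _ _).trans ?_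
        have := abs_sub x.1 θ
        rw [abs_of_nonneg hθ] at this
        simp only at hquad ⊢
        linarith
      · simp
  -- A functional vanishing on the lattice is shown to be zero, first on the factor `ℝ`, then on
  -- `V`.
  · by_contra hne
    obtain ⟨f, hf, hS⟩ := Submodule.exists_le_ker_of_lt_top _ (lt_top_iff_ne_top.2 hne)
    have hfS : ∀ q (u : D.solutions), (⟨0, q, u⟩ : D.G) ∈ Γ →
        q * f (1, 0) + f (0, (u : ℝ → V) 0) = 0 := by
      intro q u h
      have hmem : ((q, (u : ℝ → V) 0) : ℝ × V) ∈
          (D.kernelLattice Γ B hcen).map e.toLinearMap.toAddMonoidHom :=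
        ⟨(q, ⟨u, hL u ⟨q, h⟩⟩), ⟨q, u, 0, rfl, h, by simp⟩, rfl⟩
      have h0 : f (q, (u : ℝ → V) 0) = 0 := hS (Submodule.subset_span hmem)
      have hx : ((q, (u : ℝ → V) 0) : ℝ × V) = q • ((1, 0) : ℝ × V) + (0, (u : ℝ → V) 0) := by
        simp
      rwa [hx, map_add, map_smul, smul_eq_mul] at h0
    have hα : f (1, 0) = 0 := by
      by_contra hα
      obtain ⟨R, hR⟩ := hC
      let g := LinearMap.toContinuousLinearMap (f ∘ₗ LinearMap.inr ℝ ℝ V)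
      have hg : ∀ v, f (0, v) = g v := fun v => rfl
      set b := ‖g‖ * R / |f (1, 0)|
      -- If `f (1, 0) ≠ 0`, then `u(0)` determines `q`, and `‖u(0)‖ ≤ R` gives `|q| ≤ b`. This `s`
      -- is too large for such a `q` to bring it back to `[-R, R]`.
      obtain ⟨q, u, h, h1, h2⟩ := hR (R + c * (‖B 0‖ * R) * R + b + 1) 0
      rw [smul_zero, zero_add] at h1
      rw [zero_add] at h2
      have hquad := hquad (hL u ⟨q, h⟩) h2
      have hq : |q| ≤ b := by
        rw [le_div_iff₀ (abs_pos.2 hα), ← abs_mul]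
        have h3 : q * f (1, 0) = -g ((u : ℝ → V) 0) := by
          rw [← hg]
          linarith [hfS q u h]
        rw [h3, abs_neg, ← Real.norm_eq_abs]
        exact (g.le_opNorm _).trans (by gcongr)
      rw [abs_le] at h1 hq hquad
      linarith [h1.2, hq.1, hquad.2]
    have hfV : ∀ v, f (0, v) = 0 := by
      have h1 : Submodule.span ℝ (D.evalAt 0 '' D.kernelImage Γ) ≤
          LinearMap.ker (f ∘ₗ LinearMap.inr ℝ ℝ V) := by
        refine Submodule.span_le.2 ?_
        rintro _ ⟨u, ⟨q, h⟩, rfl⟩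
        have h2 := hfS q u h
        rw [hα, mul_zero, zero_add] at h2
        exact h2
      rw [D.span_evalAt_kernelImage hC] at h1
      exact fun v => h1 trivial
    refine hf (LinearMap.ext fun x => ?_)
    have hx : x = x.1 • ((1, 0) : ℝ × V) + (0, x.2) := by simp
    rw [hx, map_add, map_smul, hα, hfV]
    simp

theorem kernel_mem_iff_conj (D : ECSData V) {Γ : Subgroup D.G} {q₀ : ℝ} {u₀ : D.solutions}
    (hγ : (⟨1, q₀, u₀⟩ : D.G) ∈ Γ) (r : ℝ) (w : D.solutions) :
    (⟨0, r, w⟩ : D.G) ∈ Γ ↔ (⟨0, r - 2 * D.Omega u₀ w, D.T w⟩ : D.G) ∈ Γ := by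
  rw [← D.conj_kernel q₀ r u₀ w, Γ.mul_mem_cancel_right (inv_mem hγ), Γ.mul_mem_cancel_left hγ]

theorem exists_mem_k_eq_one (D : ECSData V) {Γ : Subgroup D.G} (h : Γ.map D.Pi = ⊤) :
    ∃ γ ∈ Γ, γ.k = 1 := by
  have h1 : Multiplicative.ofAdd (1 : ℤ) ∈ Γ.map D.Pi := h ▸ trivial
  obtain ⟨γ, hγ, h2⟩ := h1
  exact ⟨γ, hγ, congrArg Multiplicative.toAdd h2⟩

theorem exists_lattice_of_subgroup (D : ECSData V) {Γ : Subgroup D.G}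
    (hfree : ActsFreely Γ D.MHat) (hq : IsProperlyDiscontinuousCocompact Γ D.MHat)
    (hPi : Γ.map D.Pi = ⊤) :
    ∃ (B : ℝ → V →L[ℝ] V) (hB : Function.Periodic B D.p)
      (S : AddSubgroup (ℝ × firstOrderSolutions B))
      (φ : Module.Dual ℝ (firstOrderSolutions B)) (θ : ℝ),
      ContDiff ℝ ∞ B ∧
      (∀ t, deriv B t + B t * B t = D.f t • (1 : V →L[ℝ] V) + D.A) ∧
      IsLatticeIn S ∧
      0 ≤ θ ∧
      (∀ x : ℝ × firstOrderSolutions B, (x ∈ S ∧ x.2 = 0) ↔ ∃ m : ℤ, x = ((m : ℝ) * θ, 0)) ∧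
      Psi hB φ '' (S : Set (ℝ × firstOrderSolutions B)) = S ∧
      (∀ x ∈ S, ∀ y ∈ S, ∃ m : ℤ, ∀ t,
        D.wronskian (x.2 : ℝ → V) (y.2 : ℝ → V) t = (m : ℝ) * θ) := by
  have := D.finiteDimensional
  obtain ⟨γ, hγ, hγk⟩ := D.exists_mem_k_eq_one hPi
  have hP := D.finite_kernel_orbit hfree hq
  have hC := D.exists_kernel_translate hq hγ hγk
  obtain ⟨θ, hθ, hcen⟩ := D.exists_kernelCenter_eq hP
  obtain ⟨k, q₀, u₀⟩ := γ
  obtain rfl : k = 1 := hγk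
  set L₀ : Submodule ℝ D.solutions := Submodule.span ℝ (D.kernelImage Γ : Set D.solutions) with hL₀
  -- Conjugation by `γ` preserves the kernel part of `Γ` and acts on its `𝓔`-components as `T`.
  have hTinv : ∀ u ∈ L₀, D.T⁻¹ u ∈ L₀ := by
    have h1 : L₀ ≤ L₀.comap (D.T⁻¹ : D.solutions ≃ₗ[ℝ] D.solutions).toLinearMap := by
      refine Submodule.span_le.2 ?_
      rintro w ⟨r, hw⟩
      refine Submodule.subset_span ⟨r + 2 * D.Omega u₀ (D.T⁻¹ w), ?_⟩
      change (⟨0, _, D.T⁻¹ w⟩ : D.G) ∈ Γ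
      rw [D.kernel_mem_iff_conj hγ, add_sub_cancel_right]
      have : D.T (D.T⁻¹ w) = w := D.T.apply_symm_apply w
      rwa [this]
    exact h1
  obtain ⟨E, F, hE⟩ : ∃ E F, IsFrame (L₀.map D.solutions.subtype) E F := by
    refine exists_isFrame _ ?_ ?_ fun t v => ?_
    · rintro _ ⟨u, -, rfl⟩
      exact u.2.1
    · rintro _ ⟨u, hu, rfl⟩ t ht
      rw [D.eq_zero_of_mem_span_kernelImage hP (D.span_evalAt_kernelImage (hC t)) hu ht, map_zero]
    · have hv : v ∈ L₀.map (D.evalAt t) := by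
        rw [hL₀, Submodule.map_span, D.span_evalAt_kernelImage (hC t)]
        trivial
      obtain ⟨u, hu, rfl⟩ := hv
      exact ⟨u, ⟨u, hu, rfl⟩, rfl⟩
  obtain ⟨B, hBdef⟩ : ∃ B : ℝ → V →L[ℝ] V, B = fun t => deriv E t * F t := ⟨_, rfl⟩
  have hBs : ContDiff ℝ ∞ B := hBdef ▸ hE.contDiff_coefficient
  have hFOS : firstOrderSolutions B = L₀.map D.solutions.subtype :=
    hBdef ▸ hE.firstOrderSolutions_eq
  rw [← hFOS] at hE
  have hmemL : ∀ {u : D.solutions}, u ∈ L₀ → (u : ℝ → V) ∈ firstOrderSolutions B := fun hu =>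
    hFOS ▸ ⟨_, hu, rfl⟩
  have hlift : ∀ t v, ∃ u ∈ L₀, (u : ℝ → V) t = v := fun t v => by
    have h1 := hE.mem (F t v)
    rw [hFOS] at h1
    obtain ⟨u, hu, h2⟩ := h1
    exact ⟨u, hu, (congrFun h2 t).trans (hE.mul_inv t v)⟩
  have hle : firstOrderSolutions B ≤ D.solutions := by
    rw [hFOS]
    rintro _ ⟨u, -, rfl⟩
    exact u.2
  -- Both `u` and `T⁻¹ u` solve the first-order equation, and the values `u(t + p)` fill `V`.
  have hBp : Function.Periodic B D.p := by
    intro t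
    ext v
    obtain ⟨u, hu, rfl⟩ := hlift (t + D.p) v
    have h1 := deriv_eq_of_mem_firstOrderSolutions (hmemL hu) (t + D.p)
    have h2 := deriv_eq_of_mem_firstOrderSolutions (hmemL (hTinv u hu)) t
    have h3 : ((D.T⁻¹ u : D.solutions) : ℝ → V) = fun t => (u : ℝ → V) (t + D.p) := rfl
    rw [h3, deriv_comp_add_const] at h2
    exact h1.symm.trans h2
  -- Differentiate `u̇ = B u` and compare with the second-order equation on vectors `u(t)`, which
  -- fill `V`.
  have hRic : ∀ t, deriv B t + B t * B t = D.f t • (1 : V →L[ℝ] V) + D.A := by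
    intro t
    ext v
    obtain ⟨u, hu, rfl⟩ := hlift t v
    have h1 := ((hBs.differentiable (by simp) t).hasDerivAt.clm_apply
      (D.solutions_hasDerivAt u t)).deriv
    have h2 := (D.solutions_hasDerivAt_deriv u t).deriv
    rw [funext (deriv_eq_of_mem_firstOrderSolutions (hmemL hu)), h1,
      deriv_eq_of_mem_firstOrderSolutions (hmemL hu)] at h2
    simpa using h2
  let ι : firstOrderSolutions B →ₗ[ℝ] D.solutions := Submodule.inclusion hle
  let φ : Module.Dual ℝ (firstOrderSolutions B) := (-2 : ℝ) • (D.OmegaRight u₀ ∘ₗ ι)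
  have hφ : ∀ w, φ w = -2 * D.Omega u₀ (ι w) := fun w => rfl
  have hmem : ∀ {x : ℝ × firstOrderSolutions B}, x ∈ D.kernelLattice Γ B hcen ↔
      ∃ (q : ℝ) (m : ℤ), (⟨0, q, ι x.2⟩ : D.G) ∈ Γ ∧ x.1 = q + m * θ := fun {x} => by
    rw [mem_kernelLattice]
    constructor
    · rintro ⟨q, u, m, hu, h, hx⟩
      obtain rfl : u = ι x.2 := Subtype.ext hu
      exact ⟨q, m, h, hx⟩
    · rintro ⟨q, m, h, hx⟩
      exact ⟨q, _, m, rfl, h, hx⟩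
  have hPsi : ∀ x, x ∈ D.kernelLattice Γ B hcen ↔ Psi hBp φ x ∈ D.kernelLattice Γ B hcen := by
    intro x
    have hT : ι (Psi hBp φ x).2 = D.T (ι x.2) := rfl
    have h1 : (Psi hBp φ x).1 = x.1 - 2 * D.Omega u₀ (ι x.2) := by
      change x.1 + φ x.2 = _
      rw [hφ]
      ring
    rw [hmem, hmem, hT, h1]
    constructor
    · rintro ⟨q, m, h, hx⟩
      exact ⟨_, m, (D.kernel_mem_iff_conj hγ _ _).1 h, by rw [hx]; ring⟩
    · rintro ⟨q, m, h, hx⟩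
      refine ⟨q + 2 * D.Omega u₀ (ι x.2), m, (D.kernel_mem_iff_conj hγ _ _).2 ?_, by linarith⟩
      rwa [add_sub_cancel_right]
  refine ⟨B, hBp, D.kernelLattice Γ B hcen, φ, θ, hBs, hRic,
    D.isLatticeIn_kernelLattice hθ hcen hP (hC 0) hE fun u hu => hmemL (Submodule.subset_span hu),
    hθ, fun x => ?_, ?_, fun x hx y hy => ?_⟩
  · rw [hmem]
    constructor
    · rintro ⟨⟨q, m, h, hx⟩, h0⟩
      rw [h0, map_zero] at h
      obtain ⟨j, hj⟩ := (hcen q).1 h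
      refine ⟨2 * j + m, Prod.ext ?_ h0⟩
      rw [hx, hj]
      push_cast
      ring
    · rintro ⟨m, rfl⟩
      refine ⟨⟨0, m, ?_, by simp⟩, rfl⟩
      rw [map_zero]
      exact one_mem Γ
  · refine Set.Subset.antisymm ?_ fun x hx => ?_
    · rintro _ ⟨x, hx, rfl⟩
      exact (hPsi x).1 hx
    · have hinv : (fun t => (x.2 : ℝ → V) (t + D.p)) ∈ firstOrderSolutions B := fun t => by
        have h := (x.2.2 (t + D.p)).comp_add_const t D.p
        rwa [hBp] at h
      set w : firstOrderSolutions B := ⟨_, hinv⟩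
      have hw : translation hBp w = x.2 := by
        ext t
        change (x.2 : ℝ → V) (t - D.p + D.p) = _
        rw [sub_add_cancel]
      have hxw : Psi hBp φ (x.1 - φ w, w) = x := by
        refine Prod.ext ?_ hw
        exact sub_add_cancel _ _
      refine ⟨_, (hPsi _).2 ?_, hxw⟩
      rwa [hxw]
  · obtain ⟨q, m, h, -⟩ := hmem.1 hx
    obtain ⟨r, n, h', -⟩ := hmem.1 hy
    obtain ⟨j, hj⟩ := D.exists_Omega_eq hcen ⟨q, h⟩ ⟨r, h'⟩
    refine ⟨j, fun t => ?_⟩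
    rw [← hj]
    exact (D.Omega_eq (ι x.2) (ι y.2) t).symm

/-! ### From the lattice to the group `Γ` -/

theorem exists_ip_eq (D : ECSData V) (ψ : Module.Dual ℝ V) : ∃ a : V, ∀ v, D.ip a v = ψ v := by
  have := D.finiteDimensional
  have hinj : Function.Injective D.ip := by
    rw [injective_iff_map_eq_zero]
    exact fun a ha => D.ip_nondegenerate.1 a fun v => by rw [ha]; rfl
  obtain ⟨a, ha⟩ := (LinearMap.injective_iff_surjective_of_finrank_eq_finrank
    Subspace.dual_finrank_eq.symm).1 hinj ψ
  exact ⟨a, fun v => by rw [ha]⟩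

/-- The element of `G` given by an element of `ℝ × 𝓛`. -/
def ofFirstOrder (D : ECSData V) {B : ℝ → V →L[ℝ] V} (hle : firstOrderSolutions B ≤ D.solutions)
    (x : ℝ × firstOrderSolutions B) : D.G :=
  ⟨0, x.1, Submodule.inclusion hle x.2⟩

variable (D : ECSData V) {B : ℝ → V →L[ℝ] V} (hle : firstOrderSolutions B ≤ D.solutions)

theorem ofFirstOrder_smul (x : ℝ × firstOrderSolutions B) (y : D.MHat) :
    D.ofFirstOrder hle x • y = ((y.1, y.2.1 + x.1 - D.ip (B y.1 ((x.2 : ℝ → V) y.1))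
      ((2 : ℝ) • y.2.2 + (x.2 : ℝ → V) y.1), y.2.2 + (x.2 : ℝ → V) y.1) : D.MHat) := by
  rw [smul_def, ← deriv_eq_of_mem_firstOrderSolutions x.2.2]
  simp [ofFirstOrder]

theorem wronskian_firstOrder {u w : ℝ → V} (hu : u ∈ firstOrderSolutions B)
    (hw : w ∈ firstOrderSolutions B) (t : ℝ) :
    D.wronskian u w t = D.ip (B t (u t)) (w t) - D.ip (u t) (B t (w t)) := by
  rw [wronskian, deriv_eq_of_mem_firstOrderSolutions hu, deriv_eq_of_mem_firstOrderSolutions hw]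

/-- If `u₀(0) = 0`, then `Ω(u₀, w) = ⟨u̇₀(0), w(0)⟩`. By nondegeneracy this represents any
functional of `w(0)`, hence any functional on `𝓛`. -/
theorem exists_Omega_eq_dual {E F : ℝ → V →L[ℝ] V} (hE : IsFrame (firstOrderSolutions B) E F)
    (φ : Module.Dual ℝ (firstOrderSolutions B)) :
    ∃ u₀ : D.solutions, ∀ w, -2 * D.Omega u₀ (Submodule.inclusion hle w) = φ w := by
  obtain ⟨a, ha⟩ := D.exists_ip_eq ((-1 / 2 : ℝ) • (φ ∘ₗ hE.evalZero.symm.toLinearMap))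
  obtain ⟨u₀, h0, h1⟩ := D.exists_solution 0 a
  refine ⟨u₀, fun w => ?_⟩
  rw [D.Omega_eq _ _ 0, h0, h1, map_zero, LinearMap.zero_apply, sub_zero]
  have h2 := ha (hE.evalZero w)
  rw [LinearMap.smul_apply, LinearMap.comp_apply, LinearEquiv.coe_coe,
    LinearEquiv.symm_apply_apply, smul_eq_mul] at h2
  change -2 * D.ip a (hE.evalZero w) = φ w
  rw [h2]
  ring

theorem exists_subgroup_mem_iff (hB : Function.Periodic B D.p)
    {S : AddSubgroup (ℝ × firstOrderSolutions B)} {φ : Module.Dual ℝ (firstOrderSolutions B)}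
    {θ : ℝ} (hθS : ∀ m : ℤ, (((m : ℝ) * θ, 0) : ℝ × firstOrderSolutions B) ∈ S)
    (hPsi : Psi hB φ '' (S : Set (ℝ × firstOrderSolutions B)) = S)
    (hΩ : ∀ x ∈ S, ∀ y ∈ S, ∃ m : ℤ, ∀ t,
      D.wronskian (x.2 : ℝ → V) (y.2 : ℝ → V) t = (m : ℝ) * θ)
    {u₀ : D.solutions} (hu₀ : ∀ w, -2 * D.Omega u₀ (Submodule.inclusion hle w) = φ w) :
    ∃ Γ : Subgroup D.G, ∀ g, g ∈ Γ ↔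
      ∃ x ∈ S, ∃ k : ℤ, g = D.ofFirstOrder hle x * ⟨1, 0, u₀⟩ ^ k := by
  let N : Subgroup D.G :=
    { carrier := D.ofFirstOrder hle '' S
      one_mem' := ⟨0, zero_mem S, rfl⟩
      mul_mem' := by
        rintro _ _ ⟨x, hx, rfl⟩ ⟨y, hy, rfl⟩
        obtain ⟨m, hm⟩ := hΩ x hx y hy
        -- The term `-mθ` accounts for the cocycle `-Ω`.
        refine ⟨x + y + (((-m : ℤ) : ℝ) * θ, 0), add_mem (add_mem hx hy) (hθS _), ?_⟩
        simp only [ofFirstOrder]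
        rw [mul_kernel]
        have h : D.Omega (Submodule.inclusion hle x.2) (Submodule.inclusion hle y.2) = m * θ := hm 0
        rw [h]
        simp only [Prod.fst_add, Prod.snd_add, add_zero, map_add, G.mk.injEq, true_and, and_true]
        push_cast
        ring
      inv_mem' := by
        rintro _ ⟨x, hx, rfl⟩
        refine ⟨-x, neg_mem hx, ?_⟩
        simp only [ofFirstOrder]
        rw [inv_kernel]
        simp }
  have hconj : ∀ x, ⟨1, 0, u₀⟩ * D.ofFirstOrder hle x * ⟨1, 0, u₀⟩⁻¹ =
      D.ofFirstOrder hle (Psi hB φ x) := by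
    intro x
    simp only [ofFirstOrder]
    rw [conj_kernel]
    simp only [G.mk.injEq, true_and]
    refine ⟨?_, rfl⟩
    change _ = x.1 + φ x.2
    rw [← hu₀]
    ring
  have hnorm : Subgroup.zpowers (⟨1, 0, u₀⟩ : D.G) ≤ Subgroup.normalizer N := by
    rw [Subgroup.zpowers_le, Subgroup.mem_normalizer_iff]
    intro g
    constructor
    · rintro ⟨x, hx, rfl⟩
      rw [hconj]
      exact ⟨_, hPsi.subset ⟨x, hx, rfl⟩, rfl⟩
    · rintro ⟨y, hy, hyg⟩
      obtain ⟨x, hx, rfl⟩ := hPsi.superset hy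
      rw [← hconj] at hyg
      exact ⟨x, hx, mul_left_cancel (mul_right_cancel hyg)⟩
  refine ⟨N ⊔ Subgroup.zpowers ⟨1, 0, u₀⟩, fun g => ?_⟩
  rw [← SetLike.mem_coe, Subgroup.coe_mul_of_right_le_normalizer_left _ _ hnorm, Set.mem_mul]
  constructor
  · rintro ⟨_, ⟨x, hx, rfl⟩, _, ⟨k, rfl⟩, rfl⟩
    exact ⟨x, hx, k, rfl⟩
  · rintro ⟨x, hx, k, rfl⟩
    exact ⟨_, ⟨x, hx, rfl⟩, _, ⟨k, rfl⟩, rfl⟩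

/-- The coordinate `t` is unchanged, so `w(t)` is a difference of bounded vectors. Transport by `F
t` bounds `w(0)`, the `s`-coordinate then bounds the real component, and a lattice has finitely many
elements in a bounded set. -/
theorem finite_ofFirstOrder_smul (hBc : Continuous B) {E F : ℝ → V →L[ℝ] V}
    (hE : IsFrame (firstOrderSolutions B) E F) {S : AddSubgroup (ℝ × firstOrderSolutions B)}
    (hS : IsLatticeIn S) (R : ℝ) :
    {x | x ∈ S ∧ ∃ y : D.MHat, ‖y‖ ≤ R ∧ ‖D.ofFirstOrder hle x • y‖ ≤ R}.Finite := by
  have := D.finiteDimensional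
  obtain ⟨c, hc0, hc⟩ := D.exists_abs_ip_le
  obtain ⟨b, hb⟩ := (isCompact_Icc (a := -R) (b := R)).exists_bound_of_continuousOn hBc.continuousOn
  obtain ⟨a, ha⟩ := (isCompact_Icc (a := -R) (b := R)).exists_bound_of_continuousOn
    hE.smooth_inv.continuous.continuousOn
  have hfin := (hS.map (prodEvalZero hE)).finite_norm_le
    (max (R + R + c * (b * (R + R)) * (R + R)) (a * (R + R)))
  refine (hfin.preimage (prodEvalZero hE).injective.injOn).subset ?_
  rintro x ⟨hx, ⟨t, s, v⟩, hy, hxy⟩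
  rw [ofFirstOrder_smul] at hxy
  simp only [norm_prod_le_iff, Real.norm_eq_abs] at hy hxy
  obtain ⟨ht, hs, hv⟩ := hy
  obtain ⟨-, hs', hv'⟩ := hxy
  refine ⟨⟨x, hx, rfl⟩, ?_⟩
  have ht' : t ∈ Set.Icc (-R) R := abs_le.1 ht
  have hw : ‖(x.2 : ℝ → V) t‖ ≤ R + R := by
    have h := norm_sub_le (v + (x.2 : ℝ → V) t) v
    rw [add_sub_cancel_left] at h
    linarith
  have hR : 0 ≤ R := (abs_nonneg _).trans ht
  have hw0 : ‖(x.2 : ℝ → V) 0‖ ≤ a * (R + R) := by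
    rw [← hE.inv_apply x.2.2 t]
    refine ((F t).le_opNorm _).trans ?_
    have := ha t ht'
    have := (norm_nonneg _).trans this
    gcongr
  have hBw : ‖B t ((x.2 : ℝ → V) t)‖ ≤ b * (R + R) := by
    refine ((B t).le_opNorm _).trans ?_
    have := hb t ht'
    have := (norm_nonneg _).trans this
    gcongr
  have hsum : ‖(2 : ℝ) • v + (x.2 : ℝ → V) t‖ ≤ R + R := by
    have h : (2 : ℝ) • v + (x.2 : ℝ → V) t = v + (v + (x.2 : ℝ → V) t) := by
      rw [two_smul, add_assoc]
    rw [h]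
    exact (norm_add_le _ _).trans (add_le_add hv hv')
  have hip : |D.ip (B t ((x.2 : ℝ → V) t)) ((2 : ℝ) • v + (x.2 : ℝ → V) t)| ≤
      c * (b * (R + R)) * (R + R) := by
    have hb0 : 0 ≤ b := (norm_nonneg _).trans (hb t ht')
    exact (hc _ _).trans (by gcongr)
  have hx1 : |x.1| ≤ R + R + c * (b * (R + R)) * (R + R) := by
    rw [abs_le] at hs hs' hip ⊢
    constructor <;> linarith [hs.1, hs.2, hs'.1, hs'.2, hip.1, hip.2]
  rw [norm_prod_le_iff]
  exact ⟨hx1.trans (le_max_left _ _), hw0.trans (le_max_right _ _)⟩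

theorem wronskian_eq_zero_of_isLatticeIn {S : AddSubgroup (ℝ × firstOrderSolutions B)}
    (hle : firstOrderSolutions B ≤ D.solutions) (hS : IsLatticeIn S)
    (hΩ : ∀ x ∈ S, ∀ y ∈ S, ∀ t, D.wronskian (x.2 : ℝ → V) (y.2 : ℝ → V) t = 0)
    {x : ℝ × firstOrderSolutions B} (hx : x ∈ S) (w : firstOrderSolutions B) (t : ℝ) :
    D.wronskian (x.2 : ℝ → V) (w : ℝ → V) t = 0 := by
  let ι := Submodule.inclusion hle
  have h1 : (⊤ : Submodule ℝ (ℝ × firstOrderSolutions B)) ≤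
      LinearMap.ker (D.OmegaRight (ι x.2) ∘ₗ ι ∘ₗ LinearMap.snd ℝ ℝ _) := by
    rw [← hS.span_eq_top]
    exact Submodule.span_le.2 fun y hy => hΩ x hx y hy 0
  have h2 : D.Omega (ι x.2) (ι w) = 0 := h1 (x := (0, w)) trivial
  exact (D.wronskian_const (ι x.2) (ι w) t 0).trans h2

/-- In the coordinates `(s + ⟨Bv, v⟩, F t v)` a lattice element acts as a translation, apart from a
term `-Ω(w, ℓ)` with `ℓ(t) = v`. Translations by the lattice are cocompact, and the extra term is
removed modulo `θ`. -/
theorem exists_ofFirstOrder_smul_norm_le (hBc : Continuous B) {E F : ℝ → V →L[ℝ] V}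
    (hE : IsFrame (firstOrderSolutions B) E F) {S : AddSubgroup (ℝ × firstOrderSolutions B)}
    (hS : IsLatticeIn S) {θ : ℝ} (hθ : 0 ≤ θ)
    (hθS : ∀ m : ℤ, (((m : ℝ) * θ, 0) : ℝ × firstOrderSolutions B) ∈ S)
    (hΩ : ∀ x ∈ S, ∀ y ∈ S, ∃ m : ℤ, ∀ t,
      D.wronskian (x.2 : ℝ → V) (y.2 : ℝ → V) t = (m : ℝ) * θ) :
    ∃ R : ℝ, ∀ y : D.MHat, y.1 ∈ Set.Icc 0 D.p → ∃ x ∈ S, ‖D.ofFirstOrder hle x • y‖ ≤ R := by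
  have := D.finiteDimensional
  obtain ⟨c, hc0, hc⟩ := D.exists_abs_ip_le
  obtain ⟨b, hb⟩ := (isCompact_Icc (a := 0) (b := D.p)).exists_bound_of_continuousOn
    hBc.continuousOn
  obtain ⟨a, ha⟩ := (isCompact_Icc (a := 0) (b := D.p)).exists_bound_of_continuousOn
    hE.smooth.continuous.continuousOn
  obtain ⟨r, hr⟩ := (hS.map (prodEvalZero hE)).exists_norm_add_le
  refine ⟨max D.p (max (max r θ + c * (b * (a * r)) * (a * r)) (a * r)), ?_⟩
  rintro ⟨t, s, v⟩ ht
  have ht : t ∈ Set.Icc 0 D.p := ht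
  obtain ⟨_, ⟨x, hx, rfl⟩, hxr⟩ := hr (s + D.ip (B t v) v, F t v)
  set w : ℝ → V := (x.2 : ℝ → V) with hw
  have hxr' : ‖((s + D.ip (B t v) v + x.1, F t v + w 0) : ℝ × V)‖ ≤ r := hxr
  rw [norm_prod_le_iff, Real.norm_eq_abs] at hxr'
  obtain ⟨hx1, hx2⟩ := hxr'
  have hvw : v + w t = E t (F t v + w 0) := by
    rw [map_add, hE.mul_inv, ← hE.eq w x.2.2]
  have hr0 : 0 ≤ r := (norm_nonneg _).trans hx2
  have ha0 : 0 ≤ a := (norm_nonneg _).trans (ha t ht)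
  have hb0 : 0 ≤ b := (norm_nonneg _).trans (hb t ht)
  have hn1 : ‖v + w t‖ ≤ a * r := by
    rw [hvw]
    refine ((E t).le_opNorm _).trans ?_
    have := ha t ht
    gcongr
  have hn2 : ‖B t (v + w t)‖ ≤ b * (a * r) := by
    refine ((B t).le_opNorm _).trans ?_
    have := hb t ht
    gcongr
  have hip : |D.ip (B t (v + w t)) (v + w t)| ≤ c * (b * (a * r)) * (a * r) :=
    (hc _ _).trans (by gcongr)
  let ℓ : firstOrderSolutions B := ⟨_, hE.mem (F t v)⟩
  have hℓ : (ℓ : ℝ → V) t = v := hE.mul_inv t v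
  set Ω := D.wronskian w ℓ t with hΩdef
  have hΩ' : Ω = D.ip (B t (w t)) v - D.ip (w t) (B t v) := by
    rw [hΩdef, D.wronskian_firstOrder x.2.2 ℓ.2, hℓ]
  have hkey : s + x.1 - D.ip (B t (w t)) ((2 : ℝ) • v + w t) =
      s + D.ip (B t v) v + x.1 - Ω - D.ip (B t (v + w t)) (v + w t) := by
    rw [hΩ']
    have h2 := D.ip_symm.eq (w t) (B t v)
    simp only [map_add, LinearMap.add_apply, map_smul, smul_eq_mul]
    rw [h2]
    ring
  -- `ℓ` need not come from the lattice, so `Ω` is an arbitrary real number. If `θ > 0` it is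
  -- reduced modulo `θ`; if `θ = 0` it vanishes, since `Ω` is zero on the lattice and hence on its
  -- span.
  obtain ⟨m, hm⟩ : ∃ m : ℤ, |s + D.ip (B t v) v + x.1 - Ω + m * θ| ≤ max r θ := by
    rcases hθ.eq_or_lt with rfl | hθ
    · have h0 : Ω = 0 := D.wronskian_eq_zero_of_isLatticeIn hle hS
        (fun x hx y hy t => by
          obtain ⟨m, hm⟩ := hΩ x hx y hy
          rw [hm, mul_zero]) hx ℓ t
      refine ⟨0, le_trans ?_ (le_max_left _ _)⟩
      rw [h0]
      simpa using hx1
    · set z := s + D.ip (B t v) v + x.1 - Ω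
      refine ⟨-⌊z / θ⌋, le_trans ?_ (le_max_right _ _)⟩
      have h1 : z + ((-⌊z / θ⌋ : ℤ) : ℝ) * θ = Int.fract (z / θ) * θ := by
        rw [Int.fract, sub_mul, div_mul_cancel₀ _ hθ.ne']
        push_cast
        ring
      rw [h1, abs_of_nonneg (mul_nonneg (Int.fract_nonneg _) hθ.le)]
      have := (Int.fract_lt_one (z / θ)).le
      nlinarith
  refine ⟨x + (m * θ, 0), add_mem hx (hθS m), ?_⟩
  have hact : D.ofFirstOrder hle (x + (m * θ, 0)) • ((t, s, v) : D.MHat) =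
      (t, s + D.ip (B t v) v + x.1 - Ω + m * θ - D.ip (B t (v + w t)) (v + w t), v + w t) := by
    rw [ofFirstOrder_smul]
    have h1 : ((x + (m * θ, 0)).2 : ℝ → V) = w := by simp [hw]
    rw [h1]
    refine Prod.ext rfl (Prod.ext ?_ rfl)
    simp only [Prod.fst_add]
    linarith
  rw [hact, norm_prod_le_iff, norm_prod_le_iff]
  refine ⟨?_, ?_, ?_⟩
  · rw [Real.norm_eq_abs, abs_of_nonneg ht.1]
    exact ht.2.trans (le_max_left _ _)
  · refine le_trans ?_ ((le_max_left _ _).trans (le_max_right _ _))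
    exact (abs_sub _ _).trans (add_le_add hm hip)
  · exact hn1.trans ((le_max_right _ _).trans (le_max_right _ _))

end ECSData

namespace ECSData

variable {V : Type u} [NormedAddCommGroup V] [NormedSpace ℝ V]

theorem exists_subgroup_of_lattice (D : ECSData V) {B : ℝ → V →L[ℝ] V}
    (hB : Function.Periodic B D.p) {S : AddSubgroup (ℝ × firstOrderSolutions B)}
    {φ : Module.Dual ℝ (firstOrderSolutions B)} {θ : ℝ} (hBs : ContDiff ℝ ∞ B)
    (hRic : ∀ t, deriv B t + B t * B t = D.f t • (1 : V →L[ℝ] V) + D.A) (hS : IsLatticeIn S)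
    (hθ : 0 ≤ θ)
    (hθS : ∀ x : ℝ × firstOrderSolutions B, (x ∈ S ∧ x.2 = 0) ↔ ∃ m : ℤ, x = ((m : ℝ) * θ, 0))
    (hPsi : Psi hB φ '' (S : Set (ℝ × firstOrderSolutions B)) = S)
    (hΩ : ∀ x ∈ S, ∀ y ∈ S, ∃ m : ℤ, ∀ t,
      D.wronskian (x.2 : ℝ → V) (y.2 : ℝ → V) t = (m : ℝ) * θ) :
    ∃ Γ : Subgroup D.G, ActsFreely Γ D.MHat ∧ IsProperlyDiscontinuousCocompact Γ D.MHat ∧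
      Γ.map D.Pi = ⊤ := by
  have := D.finiteDimensional
  have : ProperSpace D.MHat := FiniteDimensional.proper_real _
  have hp := D.p_pos
  have hle := D.firstOrderSolutions_le hBs hRic
  have hcen : ∀ m : ℤ, (((m : ℝ) * θ, 0) : ℝ × firstOrderSolutions B) ∈ S := fun m =>
    ((hθS _).2 ⟨m, rfl⟩).1
  obtain ⟨E, F, hE⟩ := exists_isFrame_firstOrderSolutions hBs
  obtain ⟨u₀, hu₀⟩ := D.exists_Omega_eq_dual hle hE φ
  obtain ⟨Γ, hΓ⟩ := D.exists_subgroup_mem_iff hle hB hcen hPsi hΩ hu₀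
  set γ : D.G := ⟨1, 0, u₀⟩ with hγ
  have hγz : ∀ k : ℤ, (γ ^ k).k = k := fun k => by rw [zpow_k, hγ, mul_one]
  have hk : ∀ x (k : ℤ), (D.ofFirstOrder hle x * γ ^ k).k = k := fun x k => by
    rw [mul_k, hγz]
    exact zero_add k
  have hmem : ∀ x ∈ S, ∀ k : ℤ, D.ofFirstOrder hle x * γ ^ k ∈ Γ := fun x hx k =>
    (hΓ _).2 ⟨x, hx, k, rfl⟩
  have hfree : ActsFreely Γ D.MHat := by
    rintro ⟨g, hg⟩ y hgy
    obtain ⟨x, hx, k, rfl⟩ := (hΓ g).1 hg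
    have hgy : (D.ofFirstOrder hle x * γ ^ k) • y = y := hgy
    have h1 : y.1 + ((D.ofFirstOrder hle x * γ ^ k).k : ℝ) * D.p = y.1 := congrArg Prod.fst hgy
    rw [hk, add_eq_left, mul_eq_zero, or_iff_left hp.ne'] at h1
    obtain rfl : k = 0 := by exact_mod_cast h1
    rw [zpow_zero, mul_one, ofFirstOrder_smul] at hgy
    have h2 : y.2.2 + (x.2 : ℝ → V) y.1 = y.2.2 := congrArg (fun z : D.MHat => z.2.2) hgy
    rw [add_eq_left] at h2
    have h3 : x.2 = 0 := by
      refine hE.evalZero.injective ?_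
      rw [map_zero, hE.evalZero_apply, ← hE.inv_apply x.2.2 y.1, h2, map_zero]
    have h4 := congrArg (fun z : D.MHat => z.2.1) hgy
    simp only [h2, map_zero, LinearMap.zero_apply, sub_zero, add_eq_left] at h4
    refine Subtype.ext ?_
    have h5 : x = 0 := Prod.ext h4 h3
    change D.ofFirstOrder hle x * γ ^ (0 : ℤ) = 1
    rw [h5, zpow_zero, mul_one]
    rfl
  refine ⟨Γ, hfree, isProperlyDiscontinuousCocompact_of_finite
    (fun g => D.contDiff_smul g.1) hfree (fun K hK => ?_) ?_, ?_⟩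
  -- The `t`-coordinate allows only finitely many `k`; for each of them `γ ^ k` moves `K` to a
  -- bounded set, where finitely many lattice elements matter.
  · obtain ⟨R, hR⟩ := hK.isBounded.exists_norm_le
    obtain ⟨N, hN⟩ := exists_nat_gt ((R + R) / D.p)
    have hbd : ∀ k : ℤ, ∃ R' : ℝ, R ≤ R' ∧ ∀ y ∈ K, ‖γ ^ k • y‖ ≤ R' := fun k => by
      obtain ⟨r, hr⟩ := (hK.image (D.contDiff_smul (γ ^ k)).continuous).isBounded.exists_norm_le
      exact ⟨max R r, le_max_left _ _, fun y hy => (hr _ ⟨y, hy, rfl⟩).trans (le_max_right _ _)⟩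
    choose r hRr hr using hbd
    have hfin : (⋃ k ∈ Set.Icc (-(N : ℤ)) N, (fun x => D.ofFirstOrder hle x * γ ^ k) ''
        {x | x ∈ S ∧ ∃ y : D.MHat, ‖y‖ ≤ r k ∧ ‖D.ofFirstOrder hle x • y‖ ≤ r k}).Finite :=
      (Set.finite_Icc _ _).biUnion fun k _ =>
        (D.finite_ofFirstOrder_smul hle hBs.continuous hE hS (r k)).image _
    refine (hfin.preimage (f := fun g : Γ => (g : D.G)) Subtype.val_injective.injOn).subset ?_
    rintro ⟨g, hg⟩ ⟨y, hy, hgy⟩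
    obtain ⟨x, hx, k, rfl⟩ := (hΓ g).1 hg
    have hgy : (D.ofFirstOrder hle x * γ ^ k) • y ∈ K := hgy
    have h1 : |y.1| ≤ R := (norm_fst_le _).trans (hR _ hy)
    have h2 : |y.1 + k * D.p| ≤ R := by
      have h := (norm_fst_le _).trans (hR _ hgy)
      have h' : ((D.ofFirstOrder hle x * γ ^ k) • y).1 = y.1 + k * D.p := by
        rw [smul_def, hk]
      rwa [h'] at h
    have h3 : |(k : ℝ)| ≤ N := by
      have h : |(k : ℝ) * D.p| ≤ R + R := by
        rw [abs_le] at h1 h2 ⊢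
        constructor <;> linarith
      rw [abs_mul, abs_of_pos hp, ← le_div_iff₀ hp] at h
      exact h.trans hN.le
    have hkN : k ∈ Set.Icc (-(N : ℤ)) N := by
      rw [abs_le] at h3
      exact ⟨by exact_mod_cast h3.1, by exact_mod_cast h3.2⟩
    refine Set.mem_biUnion hkN ⟨x, ⟨hx, γ ^ k • y, hr k y hy, ?_⟩, rfl⟩
    rw [← mul_smul]
    exact (hR _ hgy).trans (hRr k)
  · obtain ⟨R, hR⟩ := D.exists_ofFirstOrder_smul_norm_le hle hBs.continuous hE hS hθ hcen hΩ
    refine ⟨Metric.closedBall 0 R, isCompact_closedBall _ _, fun y => ?_⟩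
    -- A power of `γ` first brings `t` into one period; the lattice then bounds `s` and `v`.
    have ht : (γ ^ (-⌊y.1 / D.p⌋) • y).1 ∈ Set.Icc 0 D.p := by
      have h : (γ ^ (-⌊y.1 / D.p⌋) • y).1 = Int.fract (y.1 / D.p) * D.p := by
        rw [smul_def, hγz, Int.fract, sub_mul, div_mul_cancel₀ _ hp.ne']
        push_cast
        ring
      rw [h]
      refine ⟨mul_nonneg (Int.fract_nonneg _) hp.le, ?_⟩
      have := (Int.fract_lt_one (y.1 / D.p)).le
      nlinarith
    obtain ⟨x, hx, hxR⟩ := hR _ ht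
    rw [← mul_smul] at hxR
    exact ⟨⟨_, hmem x hx _⟩, mem_closedBall_zero_iff.2 hxR⟩
  · refine eq_top_iff.2 fun z _ => ?_
    refine ⟨D.ofFirstOrder hle 0 * γ ^ z.toAdd, hmem 0 (zero_mem S) _, ?_⟩
    change Multiplicative.ofAdd (D.ofFirstOrder hle 0 * γ ^ z.toAdd).k = z
    rw [hk]
    rfl

end ECSData

theorem theorem6p1 {V : Type u} [NormedAddCommGroup V] [NormedSpace ℝ V] (D : ECSData V) :
    (∃ Γ : Subgroup D.G,
      ActsFreely Γ D.MHat ∧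
      IsProperlyDiscontinuousCocompact Γ D.MHat ∧
      Γ.map D.Pi = ⊤)
    ↔
    (∃ (B : ℝ → V →L[ℝ] V) (hB : Function.Periodic B D.p)
      (S : AddSubgroup (ℝ × ECSData.firstOrderSolutions B))
      (φ : Module.Dual ℝ (ECSData.firstOrderSolutions B)) (θ : ℝ),
      ContDiff ℝ ∞ B ∧
      (∀ t, deriv B t + B t * B t = D.f t • (1 : V →L[ℝ] V) + D.A) ∧
      IsLatticeIn S ∧
      0 ≤ θ ∧
      (∀ x : ℝ × ECSData.firstOrderSolutions B,
        (x ∈ S ∧ x.2 = 0) ↔ ∃ m : ℤ, x = ((m : ℝ) * θ, 0)) ∧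
      ECSData.Psi hB φ '' (S : Set (ℝ × ECSData.firstOrderSolutions B)) = S ∧
      (∀ x ∈ S, ∀ y ∈ S, ∃ m : ℤ, ∀ t,
        D.wronskian (x.2 : ℝ → V) (y.2 : ℝ → V) t = (m : ℝ) * θ)) := by
  constructor
  · rintro ⟨Γ, hfree, hq, hPi⟩
    exact D.exists_lattice_of_subgroup hfree hq hPi
  · rintro ⟨B, hB, S, φ, θ, hBs, hRic, hS, hθ, hθS, hPsi, hΩ⟩
    exact D.exists_subgroup_of_lattice hB hBs hRic hS hθ hθS hPsi hΩ
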